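/- **Setting.** Consider $n$ controllers, a horizon $T$ and a delay $k\ge 1$. Let $$X_{t+1}=A_tX_t+B_tU_t+W^0_t,\qquad Y^i_t=C^i_tX_t+W^i_t\quad(i=1,\dots,n),$$ where $X_1\sim N(0,\Sigma_x)$, $W^0_t\sim N(0,\Sigma_{w^0})$, $W^i_t\sim N(0,\Sigma_{w^i})$ are mutually independent, $Y_t=\mathrm{vec}(Y^1_t,\dots,Y^n_t)$, $U_t=\mathrm{vec}(U^1_t,\dots,U^n_t)$, $C_t$ is the stacked matrix of the $C^i_t$, and $\Sigma_w=\mathrm{diag}(\Sigma_{w^1},\dots,\Sigma_{w^n})$. Controller $i$ uses its observation $Y^i_t$, its local memory $M^i_t=\mathrm{vec}(Y^i_{t-k+1:t-1},U^i_{t-k+1:t-1})$, and the shared memory $\mathrm{vec}(Y_{1:t-k},U_{1:t-k})$. A linear strategy is a choice of matrices $K_t$, $G_t=\mathrm{diag}(G^1_t,\dots,G^n_t)$, $H_t=\mathrm{diag}(H^1_t,\dots,H^n_t)$, with $$U_t=\tilde U_t+G_tY_t+H_tM_t,\qquad \tilde U_t=K_t\,\mathrm{vec}(Y_{1:t-k},U_{1:t-k}),\qquad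 M_t=\mathrm{vec}(M^1_t,\dots,M^n_t).$$ Its cost is $J=\mathbb E\sum_{t=1}^T (X_t^{\top}QX_t+U_t^{\top}RU_t)$ with $Q\succeq 0$, $R\succ 0$. Quantities with a time index less than $1$ are $0$. Put $\hat X_{t|t-1}=\mathbb E[X_t\mid Y_{1:t-1},U_{1:t-1}]$ and $$S_t=\mathrm{vec}\big(\hat X_{t-k+1|t-k},\ \tilde U_{t-k+1:t-1},\ Y_{t-2k+2:t-k},\ U_{t-2k+2:t-k}\big).$$ **(1) Estimation does not depend on control.** Under every linear strategy, $\hat X_{1|0}=0$ almost surely. Let $P_1=\Sigma_x$ and $$P_{t+1}=A_tP_tA_t^{\top}+\Sigma_{w^0}-A_tP_tC_t^{\top}[C_tP_tC_t^{\top}+\Sigma_w]^{-1}C_tP_tA_t^{\top}.$$ If the matrices $C_tP_tC_t^{\top}+\Sigma_w$, $1\le t\le T$, are invertible, then under every linear strategy, almost surely, for $1\le t\le T$, $$\hat X_{t+1|t}=A_t\hat X_{t|t-1}+B_tU_t+A_tP_tC_t^{\top}[C_tP_tC_t^{\top}+\Sigma_w]^{-1}(Y_t-C_t\hat X_{t|t-1}),$$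 and $\mathbb E[(X_t-\hat X_{t|t-1})(X_t-\hat X_{t|t-1})^{\top}\mid Y_{1:t-1},U_{1:t-1}]=P_t$ for $1\le t\le T+1$. Neither the recursion nor $P_t$ involves the strategy. **(2) Sufficiency of $S_t$.** Fix $(G_t,H_t)_{t\le T}$. There are matrices $\Lambda_t$ and $\Pi_t$, $1\le t\le T$, which do not depend on $(K_t)$, such that for all $(K_t)$, almost surely, $$\mathbb E[\mathrm{vec}(X_t,M_t)\mid Y_{1:t-k},U_{1:t-k},\tilde U_{1:t-1}]=\Lambda_tS_t,$$ and the conditional covariance matrix of $\tilde X_t=\mathrm{vec}(X_t,Y_t,M_t)$ given $(Y_{1:t-k},U_{1:t-k},\tilde U_{1:t-1})$ is $\Pi_t$. Write the dynamics of $\tilde X_t$ as $\tilde X_{t+1}=\tilde A_t\tilde X_t+\tilde B_t\tilde U_t+\tilde F_t\,\mathrm{vec}(W^0_t,W^1_{t+1},\dots,W^n_{t+1})$, with $\tilde\Sigma_t$ the covariance matrix of the last term, and the cost of one step as $\tilde X_t^{\top}\tilde Q_t\tilde X_t+2\tilde X_t^{\top}\tilde N_t\tilde U_t+\tilde U_t^{\top}R\tilde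 U_t$. Let $V_{T+1}=0$ and, for $t\le T$, $D_t=R+\tilde B_t^{\top}V_{t+1}\tilde B_t$, $\Gamma_t=\tilde N_t^{\top}+\tilde B_t^{\top}V_{t+1}\tilde A_t$, $$V_t=\tilde A_t^{\top}V_{t+1}\tilde A_t+\tilde Q_t-\Gamma_t^{\top}D_t^{-1}\Gamma_t,\qquad \tilde L_t=-D_t^{-1}\Gamma_t\begin{bmatrix}I&0\\ C_t&0\\ 0&I\end{bmatrix}\Lambda_t .$$ Then, among all linear strategies with the given $(G_t,H_t)$ (all of them have finite cost), the minimum of $J$ is attained by one for which almost surely $$U_t=\tilde L_tS_t+G_tY_t+H_tM_t\qquad(1\le t\le T),$$ every minimizing strategy satisfies this identity almost surely, and the minimum is $$J=\sum_{t=1}^T\operatorname{tr}\big[\Pi_t\tilde Q_t+(\tilde\Sigma_t+\tilde A_t\Pi_t\tilde A_t^{\top}-\Pi_{t+1})V_{t+1}\big],$$ where the choice of $\Pi_{T+1}$ is irrelevant since $V_{T+1}=0$. In particular, every best linear strategy has this form. -/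

import Mathlib

open MeasureTheory ProbabilityTheory Matrix Finset

noncomputable section

namespace DelayedSharing

/-! ### Index types of the stacked vectors -/

/-- Coordinates of a stacked vector `vec(v¹, …, vⁿ)` with `vⁱ ∈ ℝ^{d i}`. -/
abbrev Stack {n : ℕ} (d : Fin n → ℕ) : Type := Σ i : Fin n, Fin (d i)

/-- Coordinates of `(Y_s, U_s)` for a single time `s`. -/
abbrev Obs {n : ℕ} (dy du : Fin n → ℕ) : Type := Stack dy ⊕ Stack du

/-- Coordinates of the shared memory `(Y_{1:t-k}, U_{1:t-k})`; the block `r : Fin (t - k)` is the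
time `r + 1`. -/
abbrev SharedIdx {n : ℕ} (dy du : Fin n → ℕ) (k t : ℕ) : Type := Fin (t - k) × Obs dy du

/-- Coordinates of the local memory `Mⁱ = (Yⁱ_{t-k+1:t-1}, Uⁱ_{t-k+1:t-1})` of controller `i`; the
block `j : Fin (k - 1)` is the time `t - 1 - j`. -/
abbrev LocalIdx {n : ℕ} (dy du : Fin n → ℕ) (k : ℕ) (i : Fin n) : Type :=
  Fin (k - 1) × (Fin (dy i) ⊕ Fin (du i))

/-- Coordinates of `M = vec(M¹, …, Mⁿ)`. -/
abbrev MemIdx {n : ℕ} (dy du : Fin n → ℕ) (k : ℕ) : Type := Σ i : Fin n, LocalIdx dy du k i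

/-- Coordinates of the coordinated state `vec(X, Y, M)`. -/
abbrev CoordIdx {n : ℕ} (dx : ℕ) (dy du : Fin n → ℕ) (k : ℕ) : Type :=
  Fin dx ⊕ (Stack dy ⊕ MemIdx dy du k)

/-- Coordinates of `vec(X, M)`. -/
abbrev EstIdx {n : ℕ} (dx : ℕ) (dy du : Fin n → ℕ) (k : ℕ) : Type := Fin dx ⊕ MemIdx dy du k

/-- Coordinates of the statistic
`S_t = vec(X̂_{t-k+1|t-k}, Ũ_{t-k+1:t-1}, Y_{t-2k+2:t-k}, U_{t-2k+2:t-k})`. -/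
abbrev StatIdx {n : ℕ} (dx : ℕ) (dy du : Fin n → ℕ) (k : ℕ) : Type :=
  Fin dx ⊕ ((Fin (k - 1) × Stack du) ⊕ (Fin (k - 1) × Obs dy du))

/-! ### The system, the strategies and the closed loop. Times are `1, 2, 3, …`. -/

/-- A linear system with `n` controllers, quadratic cost and Gaussian noise. -/
structure LQGSystem {n : ℕ} (dx : ℕ) (dy du : Fin n → ℕ) where
  A : ℕ → Matrix (Fin dx) (Fin dx) ℝ
  B : ℕ → Matrix (Fin dx) (Stack du) ℝ
  Ci : ℕ → (i : Fin n) → Matrix (Fin (dy i)) (Fin dx) ℝ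
  Q : Matrix (Fin dx) (Fin dx) ℝ
  R : Matrix (Stack du) (Stack du) ℝ
  covX : Matrix (Fin dx) (Fin dx) ℝ
  covW0 : Matrix (Fin dx) (Fin dx) ℝ
  covWi : (i : Fin n) → Matrix (Fin (dy i)) (Fin (dy i)) ℝ
  Q_psd : Q.PosSemidef
  R_pd : R.PosDef
  covX_psd : covX.PosSemidef
  covW0_psd : covW0.PosSemidef
  covWi_psd : ∀ i, (covWi i).PosSemidef

/-- The gains `K_t` of a linear strategy on the shared memory (stacked over the controllers). -/
abbrev SharedGain {n : ℕ} (dy du : Fin n → ℕ) (k : ℕ) : Type :=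
  (t : ℕ) → Matrix (Stack du) (SharedIdx dy du k t) ℝ

/-- The gains `Gⁱ_t` of a linear strategy on the local observations. -/
abbrev ObsGain {n : ℕ} (dy du : Fin n → ℕ) : Type :=
  ℕ → (i : Fin n) → Matrix (Fin (du i)) (Fin (dy i)) ℝ

/-- The gains `Hⁱ_t` of a linear strategy on the local memories. -/
abbrev MemGain {n : ℕ} (dy du : Fin n → ℕ) (k : ℕ) : Type :=
  ℕ → (i : Fin n) → Matrix (Fin (du i)) (LocalIdx dy du k i) ℝ

/-- A linear control strategy for `k`-step delayed sharing. -/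
structure Strategy {n : ℕ} (dy du : Fin n → ℕ) (k : ℕ) where
  K : SharedGain dy du k
  G : ObsGain dy du
  H : MemGain dy du k

/-- The values of `X_t`, `Y_t`, `Ũ_t`, `U_t` at one time. -/
@[ext]
structure Signal {n : ℕ} (dx : ℕ) (dy du : Fin n → ℕ) where
  x : Fin dx → ℝ
  y : Stack dy → ℝ
  ut : Stack du → ℝ
  u : Stack du → ℝ

/-- A realization of the primitive random variables. -/
structure Noise {n : ℕ} (dx : ℕ) (dy : Fin n → ℕ) where
  x1 : Fin dx → ℝ
  w0 : ℕ → Fin dx → ℝ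
  wi : ℕ → (i : Fin n) → Fin (dy i) → ℝ

section

variable {n dx : ℕ} {dy du : Fin n → ℕ}

/-- The stacked observation matrix `C_t`. -/
def LQGSystem.C (sys : LQGSystem dx dy du) (t : ℕ) : Matrix (Stack dy) (Fin dx) ℝ :=
  Matrix.of fun p => sys.Ci t p.1 p.2

/-- `Σ_w = diag(Σ_{w¹}, …, Σ_{wⁿ})`. -/
def LQGSystem.covW (sys : LQGSystem dx dy du) : Matrix (Stack dy) (Stack dy) ℝ :=
  Matrix.blockDiagonal' sys.covWi

/-- `G_t = diag(G¹_t, …, Gⁿ_t)`. -/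
def ObsGain.diag (G : ObsGain dy du) (t : ℕ) : Matrix (Stack du) (Stack dy) ℝ :=
  Matrix.blockDiagonal' (G t)

/-- `H_t = diag(H¹_t, …, Hⁿ_t)`. -/
def MemGain.diag {k : ℕ} (H : MemGain dy du k) (t : ℕ) :
    Matrix (Stack du) (MemIdx dy du k) ℝ :=
  Matrix.blockDiagonal' (H t)

/-- The shared memory `(Y_{1:t-k}, U_{1:t-k})` of a path `h`. -/
def sharedMem (k : ℕ) (h : ℕ → Signal dx dy du) (t : ℕ) : SharedIdx dy du k t → ℝ :=
  fun p => Sum.elim (h (p.1 + 1)).y (h (p.1 + 1)).u p.2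

/-- The local memories of a path `h`. All signals vanish at time `0`, so the truncated subtraction
makes the entries with a time before `1` equal to zero. -/
def localMem (k : ℕ) (h : ℕ → Signal dx dy du) (t : ℕ) : MemIdx dy du k → ℝ :=
  fun p => Sum.elim (fun a => (h (t - 1 - p.2.1)).y ⟨p.1, a⟩)
    (fun b => (h (t - 1 - p.2.1)).u ⟨p.1, b⟩) p.2.2

variable {k : ℕ} (sys : LQGSystem dx dy du) (σ : Strategy dy du k) (w : Noise dx dy)

/-- The state at time `t ≥ 1`, given the signals before time `t`. -/
def nextX (h : ℕ → Signal dx dy du) (t : ℕ) : Fin dx → ℝ :=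
  if t = 1 then w.x1
  else sys.A (t - 1) *ᵥ (h (t - 1)).x + sys.B (t - 1) *ᵥ (h (t - 1)).u + w.w0 (t - 1)

/-- The observations at time `t ≥ 1`, given the signals before time `t`. -/
def nextY (h : ℕ → Signal dx dy du) (t : ℕ) : Stack dy → ℝ :=
  sys.C t *ᵥ nextX sys w h t + fun p => w.wi t p.1 p.2

/-- The signals at time `t ≥ 1`, given the signals before time `t`:
`X_t = A X_{t-1} + B U_{t-1} + W⁰_{t-1}`, `Y_t = C X_t + W_t`, `Ũ_t = K_t Z_{1:t-1}`,
`U_t = Ũ_t + G_t Y_t + H_t M_t`. -/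
def next (h : ℕ → Signal dx dy du) (t : ℕ) : Signal dx dy du where
  x := nextX sys w h t
  y := nextY sys w h t
  ut := σ.K t *ᵥ sharedMem k h t
  u := σ.K t *ᵥ sharedMem k h t + σ.G.diag t *ᵥ nextY sys w h t + σ.H.diag t *ᵥ localMem k h t

/-- The closed-loop path up to time `t` (zero at time `0` and after time `t`). -/
def hist : ℕ → ℕ → Signal dx dy du
  | 0 => fun _ => ⟨0, 0, 0, 0⟩
  | t + 1 => Function.update (hist t) (t + 1) (next sys σ w (hist t) (t + 1))

/-- The closed-loop path. -/
def traj (t : ℕ) : Signal dx dy du := hist sys σ w t t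

theorem hist_eq_traj {t s : ℕ} (h : s ≤ t) : hist sys σ w t s = traj sys σ w s := by
  induction t with
  | zero => obtain rfl : s = 0 := by omega
            rfl
  | succ t ih =>
    rcases Nat.lt_or_ge t s with h' | h'
    · obtain rfl : s = t + 1 := by omega
      rfl
    · rw [hist, Function.update_of_ne (by omega), ih h']

theorem traj_zero : traj sys σ w 0 = ⟨0, 0, 0, 0⟩ := rfl

/-- The closed-loop equations hold along the closed-loop path. -/
theorem traj_eq (hk : 1 ≤ k) {t : ℕ} (ht : 1 ≤ t) :
    traj sys σ w t = next sys σ w (traj sys σ w) t := by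
  obtain ⟨t, rfl⟩ : ∃ s, t = s + 1 := ⟨t - 1, by omega⟩
  have e : traj sys σ w (t + 1) = next sys σ w (hist sys σ w t) (t + 1) := by
    simp [traj, hist]
  have hX : nextX sys w (hist sys σ w t) (t + 1) = nextX sys w (traj sys σ w) (t + 1) := by
    unfold nextX
    rw [hist_eq_traj sys σ w (show t + 1 - 1 ≤ t by omega)]
  have hS : sharedMem k (hist sys σ w t) (t + 1) = sharedMem k (traj sys σ w) (t + 1) := by
    funext p
    have hp := p.1.2
    unfold sharedMem
    rw [hist_eq_traj sys σ w (show (p.1 : ℕ) + 1 ≤ t by omega)]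
  have hL : localMem k (hist sys σ w t) (t + 1) = localMem k (traj sys σ w) (t + 1) := by
    funext p
    unfold localMem
    rw [hist_eq_traj sys σ w (show t + 1 - 1 - (p.2.1 : ℕ) ≤ t by omega)]
  rw [e]
  simp only [next, nextY, hX, hS, hL]

end

/-! ### The primitive random variables -/

/-- Labels of the primitive random variables `X_1`, `W⁰_{t+1}`, `Wⁱ_{t+1}`, `t < T`. -/
inductive PrimIdx (n T : ℕ) : Type
  | init : PrimIdx n T
  | plant (t : Fin T) : PrimIdx n T
  | sensor (t : Fin T) (i : Fin n) : PrimIdx n T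

/-- The dimension of a primitive random variable. -/
def PrimIdx.dim {n T : ℕ} (dx : ℕ) (dy : Fin n → ℕ) : PrimIdx n T → ℕ
  | .init => dx
  | .plant _ => dx
  | .sensor _ i => dy i

/-- The covariance matrix of a primitive random variable. -/
def LQGSystem.primCov {n dx T : ℕ} {dy du : Fin n → ℕ} (sys : LQGSystem dx dy du) :
    (j : PrimIdx n T) → Matrix (Fin (j.dim dx dy)) (Fin (j.dim dx dy)) ℝ
  | .init => sys.covX
  | .plant _ => sys.covW0
  | .sensor _ i => sys.covWi i

/-- The value of a primitive random variable in a noise realization. -/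
def Noise.prim {n dx T : ℕ} {dy : Fin n → ℕ} (w : Noise dx dy) :
    (j : PrimIdx n T) → Fin (j.dim dx dy) → ℝ
  | .init => w.x1
  | .plant t => w.w0 (t + 1)
  | .sensor t i => w.wi (t + 1) i

/-- `ξ` consists of mutually independent centred Gaussian vectors with the covariances of `sys`,
up to the horizon `T`. -/
structure IsPrimitive {n dx : ℕ} {dy du : Fin n → ℕ} (sys : LQGSystem dx dy du) (T : ℕ)
    {Ω : Type*} [MeasurableSpace Ω] (μ : Measure Ω) (ξ : Ω → Noise dx dy) : Prop where
  measurable : ∀ j : PrimIdx n T, Measurable fun ω => (ξ ω).prim j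
  law : ∀ j : PrimIdx n T, HasLaw (fun ω => WithLp.toLp 2 ((ξ ω).prim j))
    (multivariateGaussian 0 (sys.primCov j)) μ
  indep : iIndepFun (fun (j : PrimIdx n T) ω => (ξ ω).prim j) μ

/-! ### Information, estimates, statistic and cost -/

section

variable {n dx k : ℕ} {dy du : Fin n → ℕ} (sys : LQGSystem dx dy du) (σ : Strategy dy du k)
  {Ω : Type*} (ξ : Ω → Noise dx dy)

/-- The state process `X_t`. -/
def X (t : ℕ) (ω : Ω) : Fin dx → ℝ := (traj sys σ (ξ ω) t).x

/-- The observation process `Y_t`. -/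
def Y (t : ℕ) (ω : Ω) : Stack dy → ℝ := (traj sys σ (ξ ω) t).y

/-- The coordinator's action process `Ũ_t = K_t Z_{1:t-1}`. -/
def Ut (t : ℕ) (ω : Ω) : Stack du → ℝ := (traj sys σ (ξ ω) t).ut

/-- The control process `U_t`. -/
def U (t : ℕ) (ω : Ω) : Stack du → ℝ := (traj sys σ (ξ ω) t).u

/-- The local memory process `M_t`. -/
def M (t : ℕ) (ω : Ω) : MemIdx dy du k → ℝ := localMem k (traj sys σ (ξ ω)) t

/-- The σ-algebra generated by `Y_{1:r}, U_{1:r}`. -/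
@[reducible]
def info (r : ℕ) : MeasurableSpace Ω :=
  ⨆ s ∈ Finset.Icc 1 r,
    (MeasurableSpace.comap (Y sys σ ξ s) inferInstance ⊔
      MeasurableSpace.comap (U sys σ ξ s) inferInstance)

/-- The σ-algebra generated by `Y_{1:t-k}, U_{1:t-k}, Ũ_{1:t-1}`. -/
@[reducible]
def coordInfo (t : ℕ) : MeasurableSpace Ω :=
  info sys σ ξ (t - k) ⊔
    ⨆ s ∈ Finset.Icc 1 (t - 1), MeasurableSpace.comap (Ut sys σ ξ s) inferInstance

/-- The coordinated state `vec(X_t, Y_t, M_t)`. -/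
def coordState (t : ℕ) (ω : Ω) : CoordIdx dx dy du k → ℝ :=
  Sum.elim (X sys σ ξ t ω) (Sum.elim (Y sys σ ξ t ω) (M sys σ ξ t ω))

variable [MeasurableSpace Ω] (μ : Measure Ω)

/-- The one-step predictor `X̂_{t|t-1} = E[X_t | Y_{1:t-1}, U_{1:t-1}]` (it is `0` at `t = 0`). -/
def pred (t : ℕ) : Ω → Fin dx → ℝ := μ[X sys σ ξ t | info sys σ ξ (t - 1)]

/-- `E[vec(X_t, Y_t, M_t) | Y_{1:t-k}, U_{1:t-k}, Ũ_{1:t-1}]`. -/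
def coordEst (t : ℕ) : Ω → CoordIdx dx dy du k → ℝ :=
  μ[coordState sys σ ξ t | coordInfo sys σ ξ t]

/-- `E[vec(X_t, M_t) | Y_{1:t-k}, U_{1:t-k}, Ũ_{1:t-1}]`. -/
def stateMemEst (t : ℕ) : Ω → EstIdx dx dy du k → ℝ :=
  μ[fun ω => Sum.elim (X sys σ ξ t ω) (M sys σ ξ t ω) | coordInfo sys σ ξ t]

/-- `S_t = vec(X̂_{t-k+1|t-k}, Ũ_{t-k+1:t-1}, Y_{t-2k+2:t-k}, U_{t-2k+2:t-k})`, each window from the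
newest to the oldest time; entries with a time before `1` are zero. -/
def stat (t : ℕ) (ω : Ω) : StatIdx dx dy du k → ℝ :=
  Sum.elim (pred sys σ ξ μ (t + 1 - k) ω)
    (Sum.elim (fun p => Ut sys σ ξ (t - 1 - p.1) ω p.2)
      (fun p => Sum.elim (Y sys σ ξ (t - k - p.1) ω) (U sys σ ξ (t - k - p.1) ω) p.2))

/-- The conditional second moment matrix `E[e eᵀ | m]` of a random vector `e`. -/
def condSecondMoment {ι : Type*} (m : MeasurableSpace Ω) (e : Ω → ι → ℝ) (ω : Ω) :
    Matrix ι ι ℝ :=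
  Matrix.of fun i j => (μ[fun ω' => e ω' i * e ω' j | m]) ω

/-- The realized cost `∑_{t=1}^T (X_tᵀ Q X_t + U_tᵀ R U_t)`. -/
def pathCost (T : ℕ) (ω : Ω) : ℝ :=
  ∑ t ∈ Finset.Icc 1 T, (X sys σ ξ t ω ⬝ᵥ sys.Q *ᵥ X sys σ ξ t ω +
    U sys σ ξ t ω ⬝ᵥ sys.R *ᵥ U sys σ ξ t ω)

/-- The expected total cost. -/
def cost (T : ℕ) : ℝ := ∫ ω, pathCost sys σ ξ T ω ∂μ

end

/-! ### Precomputed matrices: the filter -/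

section

variable {n dx : ℕ} {dy du : Fin n → ℕ} (sys : LQGSystem dx dy du)

/-- The Kalman gain `A_t P C_tᵀ [C_t P C_tᵀ + Σ_w]⁻¹` for the error covariance `P`. -/
def kalmanGain (t : ℕ) (P : Matrix (Fin dx) (Fin dx) ℝ) : Matrix (Fin dx) (Stack dy) ℝ :=
  sys.A t * P * (sys.C t)ᵀ * (sys.C t * P * (sys.C t)ᵀ + sys.covW)⁻¹

/-- The forward Riccati recursion, shifted: `riccatiFrom s` is `P_{s+1}`. -/
def riccatiFrom : ℕ → Matrix (Fin dx) (Fin dx) ℝ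
  | 0 => sys.covX
  | s + 1 => sys.A (s + 1) * riccatiFrom s * (sys.A (s + 1))ᵀ + sys.covW0 -
      kalmanGain sys (s + 1) (riccatiFrom s) * sys.C (s + 1) * riccatiFrom s * (sys.A (s + 1))ᵀ

/-- The precomputed prediction error covariance `P_t`, `t ≥ 1`. -/
def riccati (t : ℕ) : Matrix (Fin dx) (Fin dx) ℝ := riccatiFrom sys (t - 1)

/-- The innovation covariance `C_t P_t C_tᵀ + Σ_w`. -/
def innovCov (t : ℕ) : Matrix (Stack dy) (Stack dy) ℝ :=
  sys.C t * riccati sys t * (sys.C t)ᵀ + sys.covW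

/-! ### Precomputed matrices: the coordinated system and the optimal gains -/

variable {k : ℕ} (G : ObsGain dy du) (H : MemGain dy du k)

/-- The matrix `P_mm` of the memory update `M_{t+1} = P_mm M_t + P_my Y_t + P_mu U_t`: every block
moves to the next older position and the oldest is dropped. -/
def Pmm (dy du : Fin n → ℕ) (k : ℕ) : Matrix (MemIdx dy du k) (MemIdx dy du k) ℝ :=
  Matrix.blockDiagonal' fun _ => Matrix.of fun p q =>
    if (p.1 : ℕ) = q.1 + 1 ∧ p.2 = q.2 then 1 else 0

/-- The matrix `P_my` of the memory update: `Y_t` enters the newest block. -/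
def Pmy (dy du : Fin n → ℕ) (k : ℕ) : Matrix (MemIdx dy du k) (Stack dy) ℝ :=
  Matrix.blockDiagonal' fun _ => Matrix.of fun p a =>
    if (p.1 : ℕ) = 0 ∧ p.2 = Sum.inl a then 1 else 0

/-- The matrix `P_mu` of the memory update: `U_t` enters the newest block. -/
def Pmu (dy du : Fin n → ℕ) (k : ℕ) : Matrix (MemIdx dy du k) (Stack du) ℝ :=
  Matrix.blockDiagonal' fun _ => Matrix.of fun p b =>
    if (p.1 : ℕ) = 0 ∧ p.2 = Sum.inr b then 1 else 0

/-- The state matrix of the coordinated system. -/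
def coordA (t : ℕ) : Matrix (CoordIdx dx dy du k) (CoordIdx dx dy du k) ℝ :=
  Matrix.fromRows
    (Matrix.fromCols (sys.A t)
      (Matrix.fromCols (sys.B t * G.diag t) (sys.B t * H.diag t)))
    (Matrix.fromRows
      (Matrix.fromCols (sys.C (t + 1) * sys.A t)
        (Matrix.fromCols (sys.C (t + 1) * sys.B t * G.diag t)
          (sys.C (t + 1) * sys.B t * H.diag t)))
      (Matrix.fromCols 0
        (Matrix.fromCols (Pmy dy du k + Pmu dy du k * G.diag t)
          (Pmm dy du k + Pmu dy du k * H.diag t))))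

/-- The input matrix of the coordinated system. -/
def coordB (k t : ℕ) : Matrix (CoordIdx dx dy du k) (Stack du) ℝ :=
  Matrix.fromRows (sys.B t) (Matrix.fromRows (sys.C (t + 1) * sys.B t) (Pmu dy du k))

/-- The matrix by which `vec(W⁰_t, W_{t+1})` enters the coordinated system. -/
def coordF (k t : ℕ) : Matrix (CoordIdx dx dy du k) (Fin dx ⊕ Stack dy) ℝ :=
  Matrix.fromRows (Matrix.fromCols 1 0)
    (Matrix.fromRows (Matrix.fromCols (sys.C (t + 1)) 1) 0)

/-- The covariance of the disturbance of the coordinated system. -/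
def coordCovW (k t : ℕ) : Matrix (CoordIdx dx dy du k) (CoordIdx dx dy du k) ℝ :=
  coordF sys k t * Matrix.fromBlocks sys.covW0 0 0 sys.covW * (coordF sys k t)ᵀ

/-- The state weight of the coordinated system. -/
def coordQ (t : ℕ) : Matrix (CoordIdx dx dy du k) (CoordIdx dx dy du k) ℝ :=
  Matrix.fromBlocks sys.Q 0 0
    (Matrix.fromBlocks ((G.diag t)ᵀ * sys.R * G.diag t) ((G.diag t)ᵀ * sys.R * H.diag t)
      ((H.diag t)ᵀ * sys.R * G.diag t) ((H.diag t)ᵀ * sys.R * H.diag t))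

/-- The state-input cross weight of the coordinated system. -/
def coordN (t : ℕ) : Matrix (CoordIdx dx dy du k) (Stack du) ℝ :=
  Matrix.fromRows 0 (Matrix.fromRows ((G.diag t)ᵀ * sys.R) ((H.diag t)ᵀ * sys.R))

/-- `Λ = Ñ_tᵀ + B̃_tᵀ S Ã_t`, for the cost-to-go matrix `S` of the next time. -/
def crossTerm (t : ℕ) (S : Matrix (CoordIdx dx dy du k) (CoordIdx dx dy du k) ℝ) :
    Matrix (Stack du) (CoordIdx dx dy du k) ℝ :=
  (coordN sys G H t)ᵀ + (coordB sys k t)ᵀ * S * coordA sys G H t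

/-- `R + B̃_tᵀ S B̃_t`, for the cost-to-go matrix `S` of the next time. -/
def inputTerm (t : ℕ) (S : Matrix (CoordIdx dx dy du k) (CoordIdx dx dy du k) ℝ) :
    Matrix (Stack du) (Stack du) ℝ :=
  sys.R + (coordB sys k t)ᵀ * S * coordB sys k t

/-- The backward Riccati recursion, by the number of remaining steps: `costToGoRev T r` is the
cost-to-go matrix at time `T + 1 - r`. -/
def costToGoRev (T : ℕ) : ℕ → Matrix (CoordIdx dx dy du k) (CoordIdx dx dy du k) ℝ
  | 0 => 0
  | r + 1 =>
    (coordA sys G H (T - r))ᵀ * costToGoRev T r * coordA sys G H (T - r) + coordQ sys G H (T - r) -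
      (crossTerm sys G H (T - r) (costToGoRev T r))ᵀ *
        (inputTerm sys (T - r) (costToGoRev T r))⁻¹ * crossTerm sys G H (T - r) (costToGoRev T r)

/-- The cost-to-go matrix `S_t`, with `S_{T+1} = 0`. -/
def costToGo (T t : ℕ) : Matrix (CoordIdx dx dy du k) (CoordIdx dx dy du k) ℝ :=
  costToGoRev sys G H T (T + 1 - t)

/-- The optimal gain `K̃_t = - [R + B̃_tᵀ S_{t+1} B̃_t]⁻¹ Λ_t` on the estimate of `vec(X, Y, M)`. -/
def coordGain (T t : ℕ) : Matrix (Stack du) (CoordIdx dx dy du k) ℝ :=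
  -((inputTerm sys t (costToGo sys G H T (t + 1)))⁻¹ *
    crossTerm sys G H t (costToGo sys G H T (t + 1)))

/-- The optimal expected cost
`∑_{t=1}^T tr(Π_t Q̃_t + (Σ̃_t + Ã_t Π_t Ã_tᵀ - Π_{t+1}) S_{t+1})` of the coordinated system, for the
error covariances `Π_t` of the estimate of `vec(X_t, Y_t, M_t)`. As `S_{T+1} = 0`, the matrix
`Π_{T+1}` is irrelevant. -/
def optCost (T : ℕ) (Pi : ℕ → Matrix (CoordIdx dx dy du k) (CoordIdx dx dy du k) ℝ) : ℝ :=
  ∑ t ∈ Finset.Icc 1 T, Matrix.trace (Pi t * coordQ sys G H t +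
    (coordCovW sys k t + coordA sys G H t * Pi t * (coordA sys G H t)ᵀ - Pi (t + 1)) *
      costToGo sys G H T (t + 1))

/-- The matrix that maps an estimate of `vec(X_t, M_t)` to the estimate of `vec(X_t, Y_t, M_t)`. -/
def embed (k t : ℕ) : Matrix (CoordIdx dx dy du k) (EstIdx dx dy du k) ℝ :=
  Matrix.fromRows (Matrix.fromCols 1 0)
    (Matrix.fromRows (Matrix.fromCols (sys.C t) 0) (Matrix.fromCols 0 1))

end

end DelayedSharing

end

open DelayedSharing

/-! Every signal of the closed loop is a linear function of the primitive Gaussian vectors, so all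
random variables in play lie in one finite-dimensional centred Gaussian space, where uncorrelated
vectors are independent. Conditioning on observations is therefore orthogonal projection onto their
span, and the conditional covariance of the residual is its constant covariance (`condExp_eq`,
`condSecondMoment_eq`). Projections exist by Gram–Schmidt without any invertibility; only the
explicit Kalman gain needs the innovation covariance to be inverted.

Estimation separates from control because controls are linear functions of observations. Passing
from one linear strategy to another changes `X_t` by a linear function of `Y_{1:t-1}`, so the
observations span the same space under every strategy (`sub_mem_obsSpan`, `obsSpan_eq`). Hence one
and the same random vector serves as prediction error for all strategies (`IsPredError.change`), and
its covariance obeys the Riccati recursion (`IsPredError.next`).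

For fixed `G`, `H`, write `X_{t-k+1}` as predictor plus error and run the dynamics forward to time
`t`. Everything that enters is either part of `S_t` or noise newer than the shared memory. Thus
`vec(X_t, M_t) = Λ_t S_t + η_t`, with `Λ_t` and `η_t` free of `K` and `η_t` orthogonal to the shared
memory (`exists_stateMem_eq`).

The optimization is an exact identity rather than a dynamic program over strategies. Completing the
square at the estimate of the coordinated state, Pythagoras for consecutive estimates, and
telescoping give `J = optCost + ∑ E[(Ũ_t - L_t S_t)ᵀ D_t (Ũ_t - L_t S_t)]` (`cost_eq_optCost_add`).
Since `D_t` is positive definite, a strategy attains the value `optCost` exactly when `Ũ_t = L_t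
S_t` almost surely for all `t`. Such a strategy exists: once the earlier gains are fixed, `S_t` is a
linear function of the shared memory, so `K_t` can be chosen recursively (`exists_sharedGain`). -/

namespace DelayedSharing

/-! ### Vectors with coordinates in a linear space of functions -/

/-- All coordinates of the vector-valued function `v` lie in the space `S` of real functions. -/
def InSpan {α ι : Type*} (S : Submodule ℝ (α → ℝ)) (v : α → ι → ℝ) : Prop :=
  ∀ i, (fun a => v a i) ∈ S

namespace InSpan

variable {α ι κ : Type*} {S S' : Submodule ℝ (α → ℝ)} {v w : α → ι → ℝ}

theorem mono (h : InSpan S v) (hS : S ≤ S') : InSpan S' v := fun i => hS (h i)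

theorem add (hv : InSpan S v) (hw : InSpan S w) : InSpan S (fun a => v a + w a) :=
  fun i => S.add_mem (hv i) (hw i)

theorem sub (hv : InSpan S v) (hw : InSpan S w) : InSpan S (fun a => v a - w a) :=
  fun i => S.sub_mem (hv i) (hw i)

theorem zero : InSpan S (fun _ => (0 : ι → ℝ)) := fun _ => S.zero_mem

theorem dotProduct [Fintype ι] (c : ι → ℝ) (hv : InSpan S v) : (fun a => c ⬝ᵥ v a) ∈ S := by
  have h : (fun a => c ⬝ᵥ v a) = ∑ i, c i • fun a => v a i := by
    funext a
    simp [_root_.dotProduct, Finset.sum_apply]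
  rw [h]
  exact S.sum_mem fun i _ => S.smul_mem _ (hv i)

theorem mulVec [Fintype ι] (A : Matrix κ ι ℝ) (hv : InSpan S v) : InSpan S (fun a => A *ᵥ v a) :=
  fun k => hv.dotProduct (A k)

theorem elim {v' : α → κ → ℝ} (hv : InSpan S v) (hw : InSpan S v') :
    InSpan S (fun a => Sum.elim (v a) (v' a)) := by
  rintro (i | i)
  · exact hv i
  · exact hw i

end InSpan

/-! ### Gaussian spaces: orthogonal projection and conditioning -/

/-- A linear space of real random variables that are centred and jointly Gaussian. -/
structure IsGaussianSpace {Ω : Type*} [MeasurableSpace Ω] (μ : Measure Ω)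
    (E : Submodule ℝ (Ω → ℝ)) : Prop where
  measurable : ∀ f ∈ E, Measurable f
  integral_eq_zero : ∀ f ∈ E, ∫ ω, f ω ∂μ = 0
  law : ∀ {ι : Type} [Fintype ι] (v : Ω → ι → ℝ), InSpan E v → HasGaussianLaw v μ

/-- The matrix `E[v wᵀ]`. -/
noncomputable def crossMoment {Ω ι κ : Type*} [MeasurableSpace Ω] (μ : Measure Ω)
    (v : Ω → ι → ℝ) (w : Ω → κ → ℝ) : Matrix ι κ ℝ :=
  Matrix.of fun i j => ∫ ω, v ω i * w ω j ∂μ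

namespace IsGaussianSpace

variable {Ω : Type*} {m mΩ : MeasurableSpace Ω} {μ : Measure Ω} {E : Submodule ℝ (Ω → ℝ)}

theorem memLp (hE : IsGaussianSpace μ E) {f : Ω → ℝ} (hf : f ∈ E) : MemLp f 2 μ := by
  have := (hE.law (fun ω (_ : Unit) => f ω) fun _ => hf).eval ()
  exact this.memLp_two

theorem integrable_mul (hE : IsGaussianSpace μ E) {f g : Ω → ℝ} (hf : f ∈ E) (hg : g ∈ E) :
    Integrable (fun ω => f ω * g ω) μ := (hE.memLp hf).integrable_mul (hE.memLp hg)

theorem integrable [IsFiniteMeasure μ] (hE : IsGaussianSpace μ E) {f : Ω → ℝ} (hf : f ∈ E) :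
    Integrable f μ := (hE.memLp hf).integrable (by norm_num)

/-- Jointly Gaussian uncorrelated vectors are independent. Joint Gaussianity comes from `law`
applied to the stacked vector, and centring identifies covariances with cross moments. -/
theorem indepFun [IsProbabilityMeasure μ] (hE : IsGaussianSpace μ E) {ι κ : Type} [Fintype ι]
    [Fintype κ] {v : Ω → ι → ℝ} {w : Ω → κ → ℝ} (hv : InSpan E v) (hw : InSpan E w)
    (h : crossMoment μ v w = 0) : IndepFun v w μ := by
  have hvw : HasGaussianLaw (fun ω => (fun i => v ω i, fun j => w ω j)) μ := by
    have h1 := hE.law _ (hv.elim hw)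
    let L : (ι ⊕ κ → ℝ) →ₗ[ℝ] (ι → ℝ) × (κ → ℝ) :=
      { toFun := fun x => (fun i => x (Sum.inl i), fun j => x (Sum.inr j))
        map_add' := fun _ _ => rfl
        map_smul' := fun _ _ => rfl }
    exact h1.map_fun L.toContinuousLinearMap
  refine hvw.indepFun_of_covariance_eval fun i j => ?_
  rw [covariance_eq_sub (hE.memLp (hv i)) (hE.memLp (hw j)), hE.integral_eq_zero _ (hv i),
    zero_mul, sub_zero]
  exact congrFun (congrFun h i) j

/-- The elements of a Gaussian space that are uncorrelated with `S`. -/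
def orth (hE : IsGaussianSpace μ E) (S : Submodule ℝ (Ω → ℝ)) : Submodule ℝ (Ω → ℝ) where
  carrier := {f | f ∈ E ∧ ∀ g ∈ S, g ∈ E → ∫ ω, f ω * g ω ∂μ = 0}
  add_mem' := by
    rintro f f' ⟨hf, h⟩ ⟨hf', h'⟩
    refine ⟨E.add_mem hf hf', fun g hg hgE => ?_⟩
    simp only [Pi.add_apply, add_mul]
    rw [integral_add (hE.integrable_mul hf hgE) (hE.integrable_mul hf' hgE), h g hg hgE,
      h' g hg hgE, add_zero]
  zero_mem' := ⟨E.zero_mem, fun g _ _ => by simp⟩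
  smul_mem' := by
    rintro c f ⟨hf, h⟩
    refine ⟨E.smul_mem c hf, fun g hg hgE => ?_⟩
    simp only [Pi.smul_apply, smul_eq_mul, mul_assoc]
    rw [integral_const_mul, h g hg hgE, mul_zero]

variable (hE : IsGaussianSpace μ E) {S : Submodule ℝ (Ω → ℝ)}

include hE in
theorem integral_mul_eq_zero_of_mem_span {s : Set (Ω → ℝ)} {f : Ω → ℝ} (hf : f ∈ E)
    (hs : s ⊆ E) (h : ∀ g ∈ s, ∫ ω, f ω * g ω ∂μ = 0) :
    ∀ g ∈ Submodule.span ℝ s, ∫ ω, f ω * g ω ∂μ = 0 := by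
  intro g hg
  have hle : Submodule.span ℝ s ≤ E := Submodule.span_le.2 hs
  induction hg using Submodule.span_induction with
  | mem g hg => exact h g hg
  | zero => simp
  | add g g' hg hg' h1 h2 =>
    simp only [Pi.add_apply, mul_add]
    rw [integral_add (hE.integrable_mul hf (hle hg)) (hE.integrable_mul hf (hle hg')), h1, h2,
      add_zero]
  | smul c g hg h1 =>
    simp only [Pi.smul_apply, smul_eq_mul, mul_left_comm _ c]
    rw [integral_const_mul, h1, mul_zero]

theorem mem_orth_span {s : Set (Ω → ℝ)} {f : Ω → ℝ} (hf : f ∈ E)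
    (hs : s ⊆ E) (h : ∀ g ∈ s, ∫ ω, f ω * g ω ∂μ = 0) : f ∈ hE.orth (Submodule.span ℝ s) :=
  ⟨hf, fun g hg _ => hE.integral_mul_eq_zero_of_mem_span hf hs h g hg⟩

theorem orth_le : hE.orth S ≤ E := fun _ hf => hf.1

theorem orth_anti {S' : Submodule ℝ (Ω → ℝ)} (h : S ≤ S') : hE.orth S' ≤ hE.orth S :=
  fun _ hf => ⟨hf.1, fun g hg => hf.2 g (h hg)⟩

theorem crossMoment_orth {ι κ : Type*} {e : Ω → ι → ℝ} {y : Ω → κ → ℝ} (he : InSpan (hE.orth S) e)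
    (hy : InSpan S y) (hS : S ≤ E) : crossMoment μ e y = 0 := by
  ext i j
  exact (he i).2 _ (hy j) (hS (hy j))

/-- Every element of a Gaussian space is the sum of an element of a finitely generated subspace and
of an element that is uncorrelated with the subspace. -/
theorem exists_sub_mem_of_fg (hS : S.FG) (hSE : S ≤ E) {f : Ω → ℝ} (hf : f ∈ E) :
    ∃ e ∈ hE.orth S, f - e ∈ S := by
  classical
  obtain ⟨s, rfl⟩ := hS
  induction s using Finset.induction_on generalizing f with
  | empty =>
    refine ⟨f, ⟨hf, fun g hg _ => ?_⟩, by simp⟩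
    have : g = 0 := by simpa using hg
    simp [this]
  | insert g s _ ih =>
    have hs : Submodule.span ℝ (s : Set (Ω → ℝ)) ≤ E :=
      (Submodule.span_mono (by simp)).trans hSE
    have hle : Submodule.span ℝ (s : Set (Ω → ℝ)) ≤
        Submodule.span ℝ ((insert g s : Finset (Ω → ℝ)) : Set (Ω → ℝ)) :=
      Submodule.span_mono (by simp)
    have hgs : g ∈ Submodule.span ℝ ((insert g s : Finset (Ω → ℝ)) : Set (Ω → ℝ)) :=
      Submodule.subset_span (by simp)
    -- Gram–Schmidt: `e` and `d` are the residuals of `f` and of the new generator `g`. Removing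
    -- from `e` its component along `d` makes it orthogonal to `g` as well.
    obtain ⟨e, he, hfe⟩ := ih hf hs
    obtain ⟨d, hd, hgd⟩ := ih (hSE hgs) hs
    set c : ℝ := (∫ ω, e ω * d ω ∂μ) / ∫ ω, d ω * d ω ∂μ with hc
    have hcd : ∫ ω, (e - c • d) ω * d ω ∂μ = 0 := by
      simp only [Pi.sub_apply, Pi.smul_apply, smul_eq_mul, sub_mul, mul_assoc]
      rw [integral_sub (hE.integrable_mul he.1 hd.1) ((hE.integrable_mul hd.1 hd.1).const_mul c),
        integral_const_mul]
      -- If `d` vanishes almost everywhere, `e` is already orthogonal to it, so the value of `c`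
      -- does not matter.
      by_cases h0 : ∫ ω, d ω * d ω ∂μ = 0
      · have h1 : (fun ω => d ω * d ω) =ᵐ[μ] 0 :=
          (integral_eq_zero_iff_of_nonneg (fun ω => mul_self_nonneg _)
            (hE.integrable_mul hd.1 hd.1)).1 h0
        have h2 : ∫ ω, e ω * d ω ∂μ = 0 := by
          refine integral_eq_zero_of_ae (h1.mono fun ω hω => ?_)
          have : d ω = 0 := by simpa using hω
          simp [this]
        rw [h0, h2, mul_zero, sub_zero]
      · rw [hc, div_mul_cancel₀ _ h0, sub_self]
    have hed : e - c • d ∈ hE.orth (Submodule.span ℝ (s : Set (Ω → ℝ))) :=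
      Submodule.sub_mem _ he (Submodule.smul_mem _ _ hd)
    refine ⟨e - c • d, hE.mem_orth_span hed.1 (Submodule.span_le.1 hSE) ?_, ?_⟩
    · intro y hy
      rcases Finset.mem_insert.1 (Finset.mem_coe.1 hy) with rfl | hy
      · have : (fun ω => (e - c • d) ω * y ω) =
            fun ω => (e - c • d) ω * (y - d) ω + (e - c • d) ω * d ω := by
          funext ω
          simp only [Pi.sub_apply]
          ring
        rw [this, integral_add (hE.integrable_mul hed.1 (hs hgd)) (hE.integrable_mul hed.1 hd.1),
          hcd, hed.2 _ hgd (hs hgd), add_zero]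
      · exact hed.2 _ (Submodule.subset_span hy) (hs (Submodule.subset_span hy))
    · have : f - (e - c • d) = (f - e) + c • (g - (g - d)) := by
        funext ω
        simp
        ring
      rw [this]
      exact Submodule.add_mem _ (hle hfe)
        (Submodule.smul_mem _ _ (Submodule.sub_mem _ hgs (hle hgd)))

theorem exists_sub_inSpan_of_fg {ι : Type*} (hS : S.FG) (hSE : S ≤ E) {v : Ω → ι → ℝ}
    (hv : InSpan E v) :
    ∃ e : Ω → ι → ℝ, InSpan (hE.orth S) e ∧ InSpan S (fun ω => v ω - e ω) := by
  choose e he hve using fun i => hE.exists_sub_mem_of_fg hS hSE (hv i)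
  exact ⟨fun ω i => e i ω, he, hve⟩

include hE in
theorem measurable_vec {ι : Type*} {v : Ω → ι → ℝ} (hv : InSpan E v) : Measurable v :=
  measurable_pi_iff.2 fun i => hE.measurable _ (hv i)

variable [IsProbabilityMeasure μ]

/-- The passage from orthogonality to conditioning; both conditional formulas below rest on it. The
σ-algebra is required to lie below that of a finite vector `w`, because independence is obtained
from joint Gaussianity of `e` and `w`. -/
theorem indep_orth {ι κ : Type} [Fintype ι] [Fintype κ] {e : Ω → ι → ℝ} {w : Ω → κ → ℝ}
    (he : InSpan (hE.orth S) e) (hw : InSpan S w) (hS : S ≤ E)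
    (hm : m ≤ MeasurableSpace.comap w inferInstance) :
    Indep (MeasurableSpace.comap e inferInstance) m μ :=
  indep_of_indep_of_le_right
    (hE.indepFun (he.mono hE.orth_le) (hw.mono hS) (hE.crossMoment_orth he hw hS)) hm

include hE in
theorem integrable_vec {ι : Type*} [Fintype ι] {v : Ω → ι → ℝ} (hv : InSpan E v) :
    Integrable v μ :=
  Integrable.of_eval fun i => hE.integrable (hv i)

/-- The conditional expectation given a σ-algebra generated by elements of `S` of a random vector
that is written as the sum of a measurable one and one that is uncorrelated with `S`. -/
theorem condExp_eq {ι κ : Type} [Fintype ι] [Fintype κ] {v y e : Ω → ι → ℝ}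
    {w : Ω → κ → ℝ} (he : InSpan (hE.orth S) e) (hw : InSpan S w) (hS : S ≤ E)
    (hm : m ≤ MeasurableSpace.comap w inferInstance)
    (hv : v = fun ω => y ω + e ω) (hy : Measurable[m] y) (hyS : InSpan E y) :
    μ[v | m] =ᵐ[μ] y := by
  have hle : m ≤ mΩ :=
    hm.trans (hE.measurable_vec (hw.mono hS)).comap_le
  have heE := he.mono hE.orth_le
  have h1 : μ[e | m] =ᵐ[μ] fun _ => μ[e] :=
    condExp_indep_eq (hE.measurable_vec heE).comap_le hle
      (comap_measurable e).stronglyMeasurable (hE.indep_orth he hw hS hm)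
  have h2 : μ[e] = 0 := by
    funext i
    rw [eval_integral fun i => hE.integrable (heE i)]
    exact hE.integral_eq_zero _ (heE i)
  have h3 : μ[v | m] =ᵐ[μ] μ[y | m] + μ[e | m] := by
    rw [hv]
    exact condExp_add (hE.integrable_vec hyS) (hE.integrable_vec heE) m
  rw [condExp_of_stronglyMeasurable hle hy.stronglyMeasurable (hE.integrable_vec hyS)] at h3
  filter_upwards [h1, h3] with ω h1 h3
  rw [h3, Pi.add_apply, h1, h2, add_zero]

/-- The conditional second moment of a random vector that is uncorrelated with `S`. -/
theorem condSecondMoment_eq {ι κ : Type} [Fintype ι] [Fintype κ] {v e : Ω → ι → ℝ}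
    {w : Ω → κ → ℝ} (he : InSpan (hE.orth S) e) (hw : InSpan S w) (hS : S ≤ E)
    (hm : m ≤ MeasurableSpace.comap w inferInstance) (hv : v =ᵐ[μ] e) :
    condSecondMoment μ m v =ᵐ[μ] fun _ => crossMoment μ e e := by
  have hle : m ≤ mΩ :=
    hm.trans (hE.measurable_vec (hw.mono hS)).comap_le
  have heE := he.mono hE.orth_le
  have key : ∀ i j, μ[fun ω => v ω i * v ω j | m] =ᵐ[μ] fun _ => crossMoment μ e e i j := by
    intro i j
    have h1 : μ[fun ω => v ω i * v ω j | m] =ᵐ[μ] μ[fun ω => e ω i * e ω j | m] :=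
      condExp_congr_ae (hv.mono fun ω hω => by simp only [hω])
    refine h1.trans (condExp_indep_eq (hE.measurable_vec heE).comap_le hle ?_
      (hE.indep_orth he hw hS hm))
    have h2 : Measurable[MeasurableSpace.comap e inferInstance] e := comap_measurable e
    exact (((measurable_pi_apply i).comp h2).mul ((measurable_pi_apply j).comp h2)).stronglyMeasurable
  have := ae_all_iff.2 fun i => ae_all_iff.2 fun j => key i j
  filter_upwards [this] with ω hω
  ext i j
  exact hω i j

end IsGaussianSpace

/-! ### The Gaussian space of the primitive random variables -/

instance {n T : ℕ} : Finite (PrimIdx n T) := by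
  let f : PrimIdx n T → Unit ⊕ (Fin T ⊕ Fin T × Fin n)
    | .init => Sum.inl ()
    | .plant t => Sum.inr (Sum.inl t)
    | .sensor t i => Sum.inr (Sum.inr (t, i))
  refine Finite.of_injective f ?_
  rintro (_ | _ | _) (_ | _ | _) h <;> simp_all [f]

section

variable {n dx T : ℕ} {dy du : Fin n → ℕ} {Ω : Type*}

/-- The linear span of the coordinates of the primitive random variables with a label in `J`. -/
def primSpan (ξ : Ω → Noise dx dy) (J : Set (PrimIdx n T)) : Submodule ℝ (Ω → ℝ) :=
  Submodule.span ℝ {f | ∃ j ∈ J, ∃ a, f = fun ω => (ξ ω).prim j a}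

variable (n T) in
/-- The labels of `X_1`, of `W⁰_s`, `s < a`, and of `Wⁱ_s`, `s < b`. -/
def past (a b : ℕ) : Set (PrimIdx n T) := {j | match j with
  | .init => True
  | .plant s => s + 1 < a
  | .sensor s _ => s + 1 < b}

theorem past_mono {a b a' b' : ℕ} (ha : a ≤ a') (hb : b ≤ b') : past n T a b ⊆ past n T a' b' := by
  rintro (_ | s | s) h
  · trivial
  · exact lt_of_lt_of_le h ha
  · exact lt_of_lt_of_le h hb

theorem primSpan_mono (ξ : Ω → Noise dx dy) {J J' : Set (PrimIdx n T)} (h : J ⊆ J') :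
    primSpan ξ J ≤ primSpan ξ J' :=
  Submodule.span_mono fun _ ⟨j, hj, a, hf⟩ => ⟨j, h hj, a, hf⟩

variable (ξ : Ω → Noise dx dy)

theorem prim_mem_primSpan {J : Set (PrimIdx n T)} {j : PrimIdx n T} (hj : j ∈ J) :
    InSpan (primSpan ξ J) (fun ω => (ξ ω).prim j) :=
  fun a => Submodule.subset_span ⟨j, hj, a, rfl⟩

theorem inSpan_x1 {a b : ℕ} : InSpan (primSpan ξ (past n T a b)) (fun ω => (ξ ω).x1) :=
  prim_mem_primSpan ξ (j := .init) trivial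

theorem inSpan_w0 {a b t : ℕ} (h1 : 1 ≤ t) (hT : t ≤ T) (ha : t < a) :
    InSpan (primSpan ξ (past n T a b)) (fun ω => (ξ ω).w0 t) := by
  obtain ⟨t, rfl⟩ := Nat.exists_eq_add_of_le' h1
  exact prim_mem_primSpan ξ (j := .plant ⟨t, hT⟩) ha

theorem inSpan_wi {a b t : ℕ} (h1 : 1 ≤ t) (hT : t ≤ T) (hb : t < b) :
    InSpan (primSpan ξ (past n T a b)) (fun ω (p : Stack dy) => (ξ ω).wi t p.1 p.2) := by
  obtain ⟨t, rfl⟩ := Nat.exists_eq_add_of_le' h1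
  intro p
  exact prim_mem_primSpan ξ (j := .sensor ⟨t, hT⟩ p.1) hb p.2

theorem primSpan_le_univ (J : Set (PrimIdx n T)) :
    primSpan ξ J ≤ primSpan ξ (Set.univ : Set (PrimIdx n T)) :=
  primSpan_mono ξ (Set.subset_univ J)

end

namespace IsPrimitive

variable {n dx T : ℕ} {dy du : Fin n → ℕ} {sys : LQGSystem dx dy du} {Ω : Type*}
  [MeasurableSpace Ω] {μ : Measure Ω} {ξ : Ω → Noise dx dy}
  (hξ : IsPrimitive sys T μ ξ)

include hξ

theorem integral_prim (j : PrimIdx n T) (a : Fin (j.dim dx dy)) :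
    ∫ ω, (ξ ω).prim j a ∂μ = 0 := by
  have h := (hξ.law j).integral_comp (f := fun x => x.ofLp a) (by fun_prop)
  have h2 : ∫ x : EuclideanSpace ℝ (Fin (j.dim dx dy)), x.ofLp a
      ∂(multivariateGaussian 0 (sys.primCov j)) = 0 := by
    have := ContinuousLinearMap.integral_comp_comm
      (EuclideanSpace.proj (𝕜 := ℝ) a : EuclideanSpace ℝ (Fin (j.dim dx dy)) →L[ℝ] ℝ)
      (IsGaussian.integrable_fun_id (μ := multivariateGaussian 0 (sys.primCov j)))
    simpa using this
  rw [← h2, ← h]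
  rfl

/-- Independent Gaussian vectors, finitely many of them, are jointly Gaussian, and linear images of
a jointly Gaussian vector are jointly Gaussian. -/
theorem isGaussianSpace : IsGaussianSpace μ (primSpan ξ (Set.univ : Set (PrimIdx n T))) where
  measurable f hf := by
    induction hf using Submodule.span_induction with
    | mem f hf =>
      obtain ⟨j, -, a, rfl⟩ := hf
      exact (measurable_pi_apply a).comp (hξ.measurable j)
    | zero => exact measurable_const
    | add f g _ _ hf hg => exact hf.add hg
    | smul c f _ hf => exact hf.const_smul c
  integral_eq_zero f hf := by
    have hZ (j : PrimIdx n T) (a : Fin (j.dim dx dy)) :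
        Integrable (fun ω => (ξ ω).prim j a) μ := by
      have h1 := (hξ.law j).hasGaussianLaw.map_fun
        (EuclideanSpace.proj (𝕜 := ℝ) a : EuclideanSpace ℝ (Fin (j.dim dx dy)) →L[ℝ] ℝ)
      exact h1.integrable
    have : Integrable f μ ∧ ∫ ω, f ω ∂μ = 0 := by
      induction hf using Submodule.span_induction with
      | mem f hf =>
        obtain ⟨j, -, a, rfl⟩ := hf
        exact ⟨hZ j a, hξ.integral_prim j a⟩
      | zero => exact ⟨integrable_zero _ _ _, by simp⟩
      | add f g _ _ hf hg =>
        refine ⟨hf.1.add hg.1, ?_⟩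
        simp only [Pi.add_apply]
        rw [integral_add hf.1 hg.1, hf.2, hg.2, add_zero]
      | smul c f _ hf =>
        refine ⟨hf.1.smul c, ?_⟩
        simp only [Pi.smul_apply, smul_eq_mul]
        rw [integral_const_mul, hf.2, mul_zero]
    exact this.2
  law {ι} _ v hv := by
    let := Fintype.ofFinite (PrimIdx n T)
    let Z : Ω → (j : PrimIdx n T) → EuclideanSpace ℝ (Fin (j.dim dx dy)) :=
      fun ω j => WithLp.toLp 2 ((ξ ω).prim j)
    have hZ : HasGaussianLaw Z μ := by
      refine iIndepFun.hasGaussianLaw (fun j => (hξ.law j).hasGaussianLaw) ?_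
      exact hξ.indep.comp (fun j => WithLp.toLp 2) fun j => by fun_prop
    have key : ∀ f ∈ primSpan ξ (Set.univ : Set (PrimIdx n T)),
        ∃ ℓ : ((j : PrimIdx n T) → EuclideanSpace ℝ (Fin (j.dim dx dy))) →L[ℝ] ℝ,
          f = fun ω => ℓ (Z ω) := by
      intro f hf
      induction hf using Submodule.span_induction with
      | mem f hf =>
        obtain ⟨j, -, a, rfl⟩ := hf
        exact ⟨(EuclideanSpace.proj a).comp (ContinuousLinearMap.proj j), rfl⟩
      | zero => exact ⟨0, rfl⟩
      | add f g _ _ hf hg =>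
        obtain ⟨a, rfl⟩ := hf
        obtain ⟨b, rfl⟩ := hg
        exact ⟨a + b, rfl⟩
      | smul c f _ hf =>
        obtain ⟨a, rfl⟩ := hf
        exact ⟨c • a, rfl⟩
    choose ℓ hℓ using fun i => key _ (hv i)
    have : v = fun ω => ContinuousLinearMap.pi ℓ (Z ω) := by
      funext ω i
      exact congrFun (hℓ i) ω
    rw [this]
    exact hZ.map_fun _

theorem crossMoment_prim_self (j : PrimIdx n T) :
    crossMoment μ (fun ω => (ξ ω).prim j) (fun ω => (ξ ω).prim j) = sys.primCov j := by
  ext a b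
  have hpsd : (sys.primCov j).PosSemidef := by
    cases j
    · exact sys.covX_psd
    · exact sys.covW0_psd
    · exact sys.covWi_psd _
  have h := (hξ.law j).integral_comp (f := fun x => x.ofLp a * x.ofLp b) (by fun_prop)
  rw [← covariance_eval_multivariateGaussian (μ := 0) hpsd a b]
  have hm (c : Fin (j.dim dx dy)) : MemLp (fun x : EuclideanSpace ℝ (Fin (j.dim dx dy)) => x.ofLp c)
      2 (multivariateGaussian 0 (sys.primCov j)) := by
    have h1 := (IsGaussian.hasGaussianLaw_id (μ := multivariateGaussian 0 (sys.primCov j))).map_fun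
      (EuclideanSpace.proj (𝕜 := ℝ) c : EuclideanSpace ℝ (Fin (j.dim dx dy)) →L[ℝ] ℝ)
    exact h1.memLp_two
  have h0 : ∫ x : EuclideanSpace ℝ (Fin (j.dim dx dy)), x.ofLp a
      ∂(multivariateGaussian 0 (sys.primCov j)) = 0 := by
    rw [← hξ.integral_prim j a]
    exact ((hξ.law j).integral_comp (f := fun x => x.ofLp a) (by fun_prop)).symm
  rw [covariance_eq_sub (hm a) (hm b), h0, zero_mul, sub_zero]
  exact h

theorem crossMoment_prim_of_ne {j j' : PrimIdx n T} (h : j ≠ j') :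
    crossMoment μ (fun ω => (ξ ω).prim j) (fun ω => (ξ ω).prim j') = 0 := by
  ext a b
  have h1 : IndepFun (fun ω => (ξ ω).prim j a) (fun ω => (ξ ω).prim j' b) μ :=
    (hξ.indep.indepFun h).comp (measurable_pi_apply a) (measurable_pi_apply b)
  have h2 := h1.integral_fun_mul_eq_mul_integral
    ((measurable_pi_apply a).comp (hξ.measurable j)).aestronglyMeasurable
    ((measurable_pi_apply b).comp (hξ.measurable j')).aestronglyMeasurable
  rw [hξ.integral_prim, zero_mul] at h2
  exact h2

theorem prim_mem_orth {J : Set (PrimIdx n T)} {j : PrimIdx n T} (hj : j ∉ J) :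
    InSpan (hξ.isGaussianSpace.orth (primSpan ξ J)) (fun ω => (ξ ω).prim j) := by
  intro a
  refine hξ.isGaussianSpace.mem_orth_span (prim_mem_primSpan ξ (Set.mem_univ j) a) ?_ ?_
  · rintro _ ⟨j', -, b, rfl⟩
    exact prim_mem_primSpan ξ (Set.mem_univ j') b
  · rintro _ ⟨j', hj', b, rfl⟩
    have hne : j ≠ j' := fun h => hj (h ▸ hj')
    exact congrFun (congrFun (hξ.crossMoment_prim_of_ne hne) a) b

theorem w0_mem_orth {a b t : ℕ} (h1 : 1 ≤ t) (hT : t ≤ T) (ha : a ≤ t) :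
    InSpan (hξ.isGaussianSpace.orth (primSpan ξ (past n T a b))) (fun ω => (ξ ω).w0 t) := by
  obtain ⟨t, rfl⟩ := Nat.exists_eq_add_of_le' h1
  exact hξ.prim_mem_orth (j := .plant ⟨t, hT⟩) (not_lt.2 ha)

theorem wi_mem_orth {a b t : ℕ} (h1 : 1 ≤ t) (hT : t ≤ T) (hb : b ≤ t) :
    InSpan (hξ.isGaussianSpace.orth (primSpan ξ (past n T a b)))
      (fun ω (p : Stack dy) => (ξ ω).wi t p.1 p.2) := by
  obtain ⟨t, rfl⟩ := Nat.exists_eq_add_of_le' h1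
  intro p
  have hj : (PrimIdx.sensor ⟨t, hT⟩ p.1 : PrimIdx n T) ∉ past n T a b := not_lt.2 hb
  have h := hξ.prim_mem_orth hj
  exact h p.2

theorem crossMoment_x1 : crossMoment μ (fun ω => (ξ ω).x1) (fun ω => (ξ ω).x1) = sys.covX :=
  hξ.crossMoment_prim_self .init

theorem crossMoment_w0 {t : ℕ} (h1 : 1 ≤ t) (hT : t ≤ T) :
    crossMoment μ (fun ω => (ξ ω).w0 t) (fun ω => (ξ ω).w0 t) = sys.covW0 := by
  obtain ⟨t, rfl⟩ := Nat.exists_eq_add_of_le' h1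
  exact hξ.crossMoment_prim_self (.plant ⟨t, hT⟩)

theorem crossMoment_w0_wi {t s : ℕ} (h1 : 1 ≤ t) (hT : t ≤ T) (hs : 1 ≤ s) (hsT : s ≤ T) :
    crossMoment μ (fun ω => (ξ ω).w0 t) (fun ω (p : Stack dy) => (ξ ω).wi s p.1 p.2) = 0 := by
  refine hξ.isGaussianSpace.crossMoment_orth
    (hξ.w0_mem_orth (a := t) (b := s + 1) h1 hT le_rfl) (inSpan_wi ξ hs hsT (Nat.lt_succ_self s))
    (primSpan_le_univ ξ _)

theorem crossMoment_wi {t : ℕ} (h1 : 1 ≤ t) (hT : t ≤ T) :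
    crossMoment μ (fun ω (p : Stack dy) => (ξ ω).wi t p.1 p.2)
      (fun ω (p : Stack dy) => (ξ ω).wi t p.1 p.2) = sys.covW := by
  obtain ⟨t, rfl⟩ := Nat.exists_eq_add_of_le' h1
  ext ⟨i, a⟩ ⟨i', b⟩
  by_cases h : i = i'
  · subst h
    rw [LQGSystem.covW, Matrix.blockDiagonal'_apply_eq]
    exact congrFun (congrFun (hξ.crossMoment_prim_self (.sensor ⟨t, hT⟩ i)) a) b
  · rw [LQGSystem.covW, Matrix.blockDiagonal'_apply_ne _ _ _ h]
    have hne : (PrimIdx.sensor ⟨t, hT⟩ i : PrimIdx n T) ≠ .sensor ⟨t, hT⟩ i' := by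
      simpa using h
    exact congrFun (congrFun (hξ.crossMoment_prim_of_ne hne) a) b

end IsPrimitive

/-! ### The closed loop as a linear function of the noise; the observation span -/

section Dynamics

variable {n dx k : ℕ} {dy du : Fin n → ℕ} (sys : LQGSystem dx dy du) (σ : Strategy dy du k)
  {Ω : Type*} (ξ : Ω → Noise dx dy)

theorem X_one (hk : 1 ≤ k) : X sys σ ξ 1 = fun ω => (ξ ω).x1 := by
  funext ω
  unfold X
  rw [traj_eq sys σ (ξ ω) hk le_rfl]
  simp [next, nextX]

theorem X_succ (hk : 1 ≤ k) {t : ℕ} (ht : 1 ≤ t) : X sys σ ξ (t + 1) = fun ω =>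
    sys.A t *ᵥ X sys σ ξ t ω + sys.B t *ᵥ U sys σ ξ t ω + (ξ ω).w0 t := by
  funext ω
  unfold X U
  rw [traj_eq sys σ (ξ ω) hk (by omega : 1 ≤ t + 1)]
  simp [next, nextX, show t ≠ 0 by omega]

theorem Y_eq (hk : 1 ≤ k) {t : ℕ} (ht : 1 ≤ t) : Y sys σ ξ t = fun ω =>
    sys.C t *ᵥ X sys σ ξ t ω + fun p => (ξ ω).wi t p.1 p.2 := by
  funext ω
  unfold X Y
  rw [traj_eq sys σ (ξ ω) hk ht]
  rfl

theorem Ut_eq (hk : 1 ≤ k) {t : ℕ} (ht : 1 ≤ t) : Ut sys σ ξ t = fun ω =>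
    σ.K t *ᵥ sharedMem k (traj sys σ (ξ ω)) t := by
  funext ω
  unfold Ut
  rw [traj_eq sys σ (ξ ω) hk ht]
  rfl

theorem U_eq (hk : 1 ≤ k) {t : ℕ} (ht : 1 ≤ t) : U sys σ ξ t = fun ω =>
    Ut sys σ ξ t ω + σ.G.diag t *ᵥ Y sys σ ξ t ω + σ.H.diag t *ᵥ M sys σ ξ t ω := by
  funext ω
  unfold Ut U Y M
  rw [traj_eq sys σ (ξ ω) hk ht]
  rfl

variable {sys σ ξ} {S : Submodule ℝ (Ω → ℝ)}

theorem inSpan_sharedMem {t : ℕ}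
    (hY : ∀ s, 1 ≤ s → s ≤ t - k → InSpan S (Y sys σ ξ s))
    (hU : ∀ s, 1 ≤ s → s ≤ t - k → InSpan S (U sys σ ξ s)) :
    InSpan S (fun ω => sharedMem k (traj sys σ (ξ ω)) t) := by
  rintro ⟨r, a | b⟩
  · exact hY (r + 1) (by omega) (by omega) a
  · exact hU (r + 1) (by omega) (by omega) b

/-- The alternative `s = 0` covers the memory blocks before time `1`, which truncated subtraction
sends to the zero signal. -/
theorem inSpan_M {t : ℕ}
    (hY : ∀ s, s + k ≥ t + 1 ∨ s = 0 → s ≤ t - 1 → InSpan S (Y sys σ ξ s))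
    (hU : ∀ s, s + k ≥ t + 1 ∨ s = 0 → s ≤ t - 1 → InSpan S (U sys σ ξ s)) :
    InSpan S (M sys σ ξ t) := by
  rintro ⟨i, j, a | b⟩
  · exact hY (t - 1 - j) (by omega) (by omega) ⟨i, a⟩
  · exact hU (t - 1 - j) (by omega) (by omega) ⟨i, b⟩

/-- The feedback law, unrolled recursively, expresses each control by observations. This is why
`obsSpan` below can leave the controls out. -/
theorem inSpan_U (hk : 1 ≤ k) {t : ℕ} (hY : ∀ s ≤ t, InSpan S (Y sys σ ξ s)) :
    InSpan S (U sys σ ξ t) := by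
  induction t using Nat.strong_induction_on with
  | _ t ih =>
  rcases Nat.eq_zero_or_pos t with rfl | ht
  · exact InSpan.zero
  have hU : ∀ s < t, InSpan S (U sys σ ξ s) := fun s hs => ih s hs fun r hr => hY r (by omega)
  rw [U_eq sys σ ξ hk ht, Ut_eq sys σ ξ hk ht]
  refine (((inSpan_sharedMem (fun s _ _ => hY s (by omega))
    (fun s _ _ => hU s (by omega))).mulVec _).add ((hY t le_rfl).mulVec _)).add
    ((inSpan_M (fun s _ _ => hY s (by omega)) (fun s _ _ => hU s (by omega))).mulVec _)

theorem inSpan_Ut (hk : 1 ≤ k) {t : ℕ} (hY : ∀ s ≤ t - k, InSpan S (Y sys σ ξ s)) :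
    InSpan S (Ut sys σ ξ t) := by
  rcases Nat.eq_zero_or_pos t with rfl | ht
  · exact InSpan.zero
  rw [Ut_eq sys σ ξ hk ht]
  exact (inSpan_sharedMem (fun s _ hs => hY s hs)
    (fun s _ hs => inSpan_U hk fun r hr => hY r (hr.trans hs))).mulVec _

/-- Causality. The state at `t` has seen only noise before `t`, while the observation at `t` also
contains the sensor noise at `t`; hence the two separate cut-offs of `past`. -/
theorem inSpan_past (hk : 1 ≤ k) (T t : ℕ) :
    (t ≤ T + 1 → InSpan (primSpan ξ (past n T t t)) (X sys σ ξ t)) ∧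
    (t ≤ T → InSpan (primSpan ξ (past n T t (t + 1))) (Y sys σ ξ t)) := by
  induction t using Nat.strong_induction_on with
  | _ t ih =>
  rcases Nat.eq_zero_or_pos t with rfl | ht
  · exact ⟨fun _ => InSpan.zero, fun _ => InSpan.zero⟩
  have hX : t ≤ T + 1 → InSpan (primSpan ξ (past n T t t)) (X sys σ ξ t) := by
    intro htT
    obtain ⟨t, rfl⟩ := Nat.exists_eq_add_of_le' ht
    rcases Nat.eq_zero_or_pos t with rfl | ht'
    · rw [X_one sys σ ξ hk]
      exact inSpan_x1 ξ
    rw [X_succ sys σ ξ hk ht']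
    have h1 : InSpan (primSpan ξ (past n T (t + 1) (t + 1))) (U sys σ ξ t) :=
      inSpan_U hk fun s hs => ((ih s (by omega)).2 (by omega)).mono
        (primSpan_mono ξ (past_mono (by omega) (by omega)))
    exact ((((ih t (by omega)).1 (by omega)).mono
      (primSpan_mono ξ (past_mono (by omega) (by omega)))).mulVec _ |>.add (h1.mulVec _)).add
      (inSpan_w0 ξ ht' (by omega) (by omega))
  refine ⟨hX, fun htT => ?_⟩
  rw [Y_eq sys σ ξ hk ht]
  exact (((hX (by omega)).mono (primSpan_mono ξ (past_mono (by omega) (by omega)))).mulVec _).add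
    (inSpan_wi ξ ht htT (by omega))

theorem inSpan_past_X (hk : 1 ≤ k) {T t a b : ℕ} (ht : t ≤ T + 1) (ha : t ≤ a) (hb : t ≤ b) :
    InSpan (primSpan ξ (past n T a b)) (X sys σ ξ t) :=
  ((inSpan_past hk T t).1 ht).mono (primSpan_mono ξ (past_mono ha hb))

theorem inSpan_past_Y (hk : 1 ≤ k) {T t a b : ℕ} (ht : t ≤ T) (ha : t ≤ a) (hb : t + 1 ≤ b) :
    InSpan (primSpan ξ (past n T a b)) (Y sys σ ξ t) :=
  ((inSpan_past hk T t).2 ht).mono (primSpan_mono ξ (past_mono ha hb))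

theorem inSpan_past_U (hk : 1 ≤ k) {T t a b : ℕ} (ht : t ≤ T) (ha : t ≤ a) (hb : t + 1 ≤ b) :
    InSpan (primSpan ξ (past n T a b)) (U sys σ ξ t) :=
  inSpan_U hk fun _ hs => inSpan_past_Y hk (by omega) (by omega) (by omega)

theorem inSpan_past_M (hk : 1 ≤ k) {T t a b : ℕ} (ht : t ≤ T) (ha : t ≤ a) (hb : t + 1 ≤ b) :
    InSpan (primSpan ξ (past n T a b)) (M sys σ ξ t) :=
  inSpan_M (fun _ _ _ => inSpan_past_Y hk (by omega) (by omega) (by omega))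
    (fun _ _ _ => inSpan_past_U hk (by omega) (by omega) (by omega))

theorem inSpan_past_coordState (hk : 1 ≤ k) {T t a b : ℕ} (ht : t ≤ T) (ha : t ≤ a)
    (hb : t + 1 ≤ b) : InSpan (primSpan ξ (past n T a b)) (coordState sys σ ξ t) :=
  (inSpan_past_X hk (by omega) ha (by omega)).elim
    ((inSpan_past_Y hk ht ha hb).elim (inSpan_past_M hk ht ha hb))

variable (sys σ ξ)

/-- The linear span of the coordinates of the observations up to time `r`. -/
def obsSpan (r : ℕ) : Submodule ℝ (Ω → ℝ) :=
  Submodule.span ℝ {f | ∃ s ∈ Icc 1 r, ∃ p, f = fun ω => Y sys σ ξ s ω p}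

theorem obsSpan_mono {r r' : ℕ} (h : r ≤ r') : obsSpan sys σ ξ r ≤ obsSpan sys σ ξ r' :=
  Submodule.span_mono fun _ ⟨s, hs, p, hf⟩ => ⟨s, Icc_subset_Icc le_rfl h hs, p, hf⟩

theorem obsSpan_fg (r : ℕ) : (obsSpan sys σ ξ r).FG := by
  refine Submodule.fg_span (Set.Finite.subset ((Icc 1 r).finite_toSet.biUnion
    (t := fun s => Set.range fun p => fun ω => Y sys σ ξ s ω p)
    fun s _ => Set.finite_range _) ?_)
  rintro _ ⟨s, hs, p, rfl⟩
  exact Set.mem_biUnion (Finset.mem_coe.2 hs) ⟨p, rfl⟩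

theorem Y_mem_obsSpan {s r : ℕ} (h : s ≤ r) : InSpan (obsSpan sys σ ξ r) (Y sys σ ξ s) := by
  rcases Nat.eq_zero_or_pos s with rfl | hs
  · exact InSpan.zero
  · exact fun p => Submodule.subset_span ⟨s, mem_Icc.2 ⟨hs, h⟩, p, rfl⟩

theorem U_mem_obsSpan (hk : 1 ≤ k) {s r : ℕ} (h : s ≤ r) :
    InSpan (obsSpan sys σ ξ r) (U sys σ ξ s) :=
  inSpan_U hk fun _ hs => Y_mem_obsSpan sys σ ξ (hs.trans h)

theorem Ut_mem_obsSpan (hk : 1 ≤ k) {s r : ℕ} (h : s - k ≤ r) :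
    InSpan (obsSpan sys σ ξ r) (Ut sys σ ξ s) :=
  inSpan_Ut hk fun _ hs => Y_mem_obsSpan sys σ ξ (hs.trans h)

theorem obsSpan_le_past (hk : 1 ≤ k) {T r a b : ℕ} (hr : r ≤ T) (ha : r ≤ a) (hb : r + 1 ≤ b) :
    obsSpan sys σ ξ r ≤ primSpan ξ (past n T a b) := by
  refine Submodule.span_le.2 ?_
  rintro _ ⟨s, hs, p, rfl⟩
  have := mem_Icc.1 hs
  exact inSpan_past_Y hk (by omega) (by omega) (by omega) p

theorem obsSpan_le_univ (hk : 1 ≤ k) {T r : ℕ} (hr : r ≤ T) :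
    obsSpan sys σ ξ r ≤ primSpan ξ (Set.univ : Set (PrimIdx n T)) :=
  (obsSpan_le_past sys σ ξ hk hr le_rfl le_rfl).trans (primSpan_le_univ ξ _)

variable (σ' : Strategy dy du k)

/-- The noise cancels in the difference of two closed loops. What remains is driven by the
difference of the controls, and both controls are linear in the observations under `σ`: the one of
`σ'` by induction on time. -/
theorem sub_mem_obsSpan (hk : 1 ≤ k) (t : ℕ) :
    InSpan (obsSpan sys σ ξ (t - 1)) (fun ω => X sys σ' ξ t ω - X sys σ ξ t ω) ∧
      InSpan (obsSpan sys σ ξ t) (Y sys σ' ξ t) := by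
  induction t using Nat.strong_induction_on with
  | _ t ih =>
  rcases Nat.eq_zero_or_pos t with rfl | ht
  · exact ⟨InSpan.zero.sub InSpan.zero, InSpan.zero⟩
  have hX : InSpan (obsSpan sys σ ξ (t - 1)) (fun ω => X sys σ' ξ t ω - X sys σ ξ t ω) := by
    obtain ⟨t, rfl⟩ := Nat.exists_eq_add_of_le' ht
    rcases Nat.eq_zero_or_pos t with rfl | ht'
    · rw [X_one sys σ ξ hk, X_one sys σ' ξ hk]
      convert InSpan.zero (S := obsSpan sys σ ξ (0 + 1 - 1)) using 2
      exact sub_self _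
    rw [X_succ sys σ ξ hk ht', X_succ sys σ' ξ hk ht']
    have h1 : InSpan (obsSpan sys σ ξ t) (U sys σ' ξ t) :=
      inSpan_U hk fun s hs => (ih s (by omega)).2.mono (obsSpan_mono sys σ ξ hs)
    have h2 := (((ih t (by omega)).1.mono (obsSpan_mono sys σ ξ (by omega : t - 1 ≤ t))).mulVec
      (sys.A t)).add ((h1.sub (U_mem_obsSpan sys σ ξ hk le_rfl)).mulVec (sys.B t))
    convert h2 using 2
    · rfl
    · simp only [mulVec_sub]
      abel
  refine ⟨hX, ?_⟩
  have h := (Y_mem_obsSpan sys σ ξ (le_refl t)).add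
    ((hX.mono (obsSpan_mono sys σ ξ (by omega : t - 1 ≤ t))).mulVec (sys.C t))
  convert h using 2
  rw [Y_eq sys σ ξ hk ht, Y_eq sys σ' ξ hk ht]
  simp only [mulVec_sub]
  abel

/-- The observations of all linear strategies have the same linear span. -/
theorem obsSpan_eq (hk : 1 ≤ k) (r : ℕ) : obsSpan sys σ ξ r = obsSpan sys σ' ξ r := by
  have h : ∀ σ σ' : Strategy dy du k, obsSpan sys σ' ξ r ≤ obsSpan sys σ ξ r := by
    intro σ σ'
    refine Submodule.span_le.2 ?_
    rintro _ ⟨s, hs, p, rfl⟩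
    exact ((sub_mem_obsSpan sys σ ξ σ' hk s).2.mono (obsSpan_mono sys σ ξ (mem_Icc.1 hs).2)) p
  exact le_antisymm (h σ' σ) (h σ σ')

theorem measurable_Y_info {s r : ℕ} (h : s ≤ r) : Measurable[info sys σ ξ r] (Y sys σ ξ s) := by
  rcases Nat.eq_zero_or_pos s with rfl | hs
  · exact measurable_const
  exact (measurable_iff_comap_le (m₁ := info sys σ ξ r)).2 <| le_trans le_sup_left (le_iSup₂_of_le s (mem_Icc.2 ⟨hs, h⟩) le_rfl)

theorem measurable_of_mem_obsSpan {r : ℕ} {f : Ω → ℝ} (hf : f ∈ obsSpan sys σ ξ r) :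
    Measurable[info sys σ ξ r] f := by
  induction hf using Submodule.span_induction with
  | mem f hf =>
    obtain ⟨s, hs, p, rfl⟩ := hf
    exact (measurable_pi_apply p).comp (measurable_Y_info sys σ ξ (mem_Icc.1 hs).2)
  | zero => exact measurable_const
  | add f g _ _ hf hg => exact Measurable.add hf hg
  | smul c f _ hf => exact Measurable.const_smul hf c

theorem measurable_of_inSpan_obsSpan {ι : Type*} {r : ℕ} {v : Ω → ι → ℝ}
    (hv : InSpan (obsSpan sys σ ξ r) v) : Measurable[info sys σ ξ r] v := by
  let := info sys σ ξ r
  exact measurable_pi_iff.2 fun i => measurable_of_mem_obsSpan sys σ ξ (hv i)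

/-- The observations and controls up to time `r`. -/
def obsVec (r : ℕ) (ω : Ω) : Fin r × Obs dy du → ℝ :=
  fun p => Sum.elim (Y sys σ ξ (p.1 + 1) ω) (U sys σ ξ (p.1 + 1) ω) p.2

theorem obsVec_mem (hk : 1 ≤ k) (r : ℕ) : InSpan (obsSpan sys σ ξ r) (obsVec sys σ ξ r) := by
  rintro ⟨s, a | b⟩
  · exact Y_mem_obsSpan sys σ ξ (by omega : (s : ℕ) + 1 ≤ r) a
  · exact U_mem_obsSpan sys σ ξ hk (by omega : (s : ℕ) + 1 ≤ r) b

/-- Brings the information σ-algebra into the form required by `indep_orth`. -/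
theorem info_le_comap (r : ℕ) :
    info sys σ ξ r ≤ MeasurableSpace.comap (obsVec sys σ ξ r) inferInstance := by
  refine iSup₂_le fun s hs => ?_
  obtain ⟨h1, h2⟩ := mem_Icc.1 hs
  set mc := MeasurableSpace.comap (obsVec sys σ ξ r) inferInstance
  have hc : Measurable[mc] (obsVec sys σ ξ r) := comap_measurable _
  have hcoord : ∀ q : Obs dy du,
      Measurable[mc] (fun ω => Sum.elim (Y sys σ ξ s ω) (U sys σ ξ s ω) q) := by
    intro q
    have := (measurable_pi_apply ((⟨s - 1, by omega⟩, q) : Fin r × Obs dy du)).comp hc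
    have hs1 : s - 1 + 1 = s := by omega
    convert this using 1
    funext ω
    simp [obsVec, hs1]
  refine sup_le ((measurable_iff_comap_le (m₁ := mc)).1 ?_)
    ((measurable_iff_comap_le (m₁ := mc)).1 ?_)
  · exact measurable_pi_iff.2 fun a => hcoord (Sum.inl a)
  · exact measurable_pi_iff.2 fun b => hcoord (Sum.inr b)

/-- The coordinator's past actions are functions of the shared memory. -/
theorem coordInfo_eq (hk : 1 ≤ k) (t : ℕ) : coordInfo sys σ ξ t = info sys σ ξ (t - k) := by
  refine le_antisymm (sup_le le_rfl (iSup₂_le fun s hs => ?_)) le_sup_left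
  have := mem_Icc.1 hs
  exact (measurable_of_inSpan_obsSpan sys σ ξ
    (Ut_mem_obsSpan sys σ ξ hk (by omega : s - k ≤ t - k))).comap_le

end Dynamics

/-! ### Bilinearity of cross moments -/

namespace IsGaussianSpace

variable {Ω : Type*} {mΩ : MeasurableSpace Ω} {μ : Measure Ω} {E : Submodule ℝ (Ω → ℝ)}
  (hE : IsGaussianSpace μ E) {ι κ ρ : Type*} {v v' : Ω → ι → ℝ} {w w' : Ω → κ → ℝ}

include hE

theorem crossMoment_add_left (hv : InSpan E v) (hv' : InSpan E v') (hw : InSpan E w) :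
    crossMoment μ (fun ω => v ω + v' ω) w = crossMoment μ v w + crossMoment μ v' w := by
  ext i j
  simp only [crossMoment, Pi.add_apply, add_mul, of_apply, Matrix.add_apply]
  exact integral_add (hE.integrable_mul (hv i) (hw j)) (hE.integrable_mul (hv' i) (hw j))

theorem crossMoment_sub_left (hv : InSpan E v) (hv' : InSpan E v') (hw : InSpan E w) :
    crossMoment μ (fun ω => v ω - v' ω) w = crossMoment μ v w - crossMoment μ v' w := by
  ext i j
  simp only [crossMoment, Pi.sub_apply, sub_mul, of_apply, Matrix.sub_apply]
  exact integral_sub (hE.integrable_mul (hv i) (hw j)) (hE.integrable_mul (hv' i) (hw j))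

theorem crossMoment_mulVec_left [Fintype ι] (A : Matrix ρ ι ℝ) (hv : InSpan E v)
    (hw : InSpan E w) : crossMoment μ (fun ω => A *ᵥ v ω) w = A * crossMoment μ v w := by
  ext i j
  simp only [crossMoment, mulVec, dotProduct, Matrix.mul_apply, of_apply, Finset.sum_mul, mul_assoc]
  rw [integral_finsetSum _ fun l _ => (hE.integrable_mul (hv l) (hw j)).const_mul _]
  simp only [integral_const_mul]

omit hE in
theorem crossMoment_transpose (v : Ω → ι → ℝ) (w : Ω → κ → ℝ) :
    (crossMoment μ v w)ᵀ = crossMoment μ w v := by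
  ext i j
  simp only [crossMoment, transpose_apply, of_apply, mul_comm]

theorem crossMoment_add_right (hv : InSpan E v) (hw : InSpan E w) (hw' : InSpan E w') :
    crossMoment μ v (fun ω => w ω + w' ω) = crossMoment μ v w + crossMoment μ v w' := by
  rw [← crossMoment_transpose, hE.crossMoment_add_left hw hw' hv, transpose_add,
    crossMoment_transpose, crossMoment_transpose]

theorem crossMoment_sub_right (hv : InSpan E v) (hw : InSpan E w) (hw' : InSpan E w') :
    crossMoment μ v (fun ω => w ω - w' ω) = crossMoment μ v w - crossMoment μ v w' := by
  rw [← crossMoment_transpose, hE.crossMoment_sub_left hw hw' hv, transpose_sub,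
    crossMoment_transpose, crossMoment_transpose]

theorem crossMoment_mulVec_right [Fintype κ] (A : Matrix ρ κ ℝ) (hv : InSpan E v)
    (hw : InSpan E w) : crossMoment μ v (fun ω => A *ᵥ w ω) = crossMoment μ v w * Aᵀ := by
  rw [← crossMoment_transpose, hE.crossMoment_mulVec_left A hw hv, transpose_mul,
    crossMoment_transpose]

end IsGaussianSpace

/-! ### Prediction errors and the Kalman filter -/

/-- `e` is an error of the prediction of `X_t`: it is uncorrelated with the observations before `t`
and differs from `X_t` by a linear function of them. The strategy `σ` is irrelevant. -/
structure IsPredError {n dx k T : ℕ} {dy du : Fin n → ℕ} {sys : LQGSystem dx dy du} {Ω : Type*}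
    {mΩ : MeasurableSpace Ω} {μ : Measure Ω} {ξ : Ω → Noise dx dy} (hξ : IsPrimitive sys T μ ξ)
    (σ : Strategy dy du k) (t : ℕ) (e : Ω → Fin dx → ℝ) : Prop where
  orth : InSpan (hξ.isGaussianSpace.orth (obsSpan sys σ ξ (t - 1))) e
  sub : InSpan (obsSpan sys σ ξ (t - 1)) (fun ω => X sys σ ξ t ω - e ω)

section

variable {n dx k T : ℕ} {dy du : Fin n → ℕ} {sys : LQGSystem dx dy du}
  {Ω : Type*} {mΩ : MeasurableSpace Ω} {μ : Measure Ω} {ξ : Ω → Noise dx dy}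
  {hξ : IsPrimitive sys T μ ξ} {σ : Strategy dy du k} {t : ℕ} {e : Ω → Fin dx → ℝ}

/-- The states under `σ` and `σ'` differ by an element of the common observation span, so the same
`e` is the residual of both. This is the independence of estimation from control. -/
theorem IsPredError.change (hk : 1 ≤ k) (he : IsPredError hξ σ t e) (σ' : Strategy dy du k) :
    IsPredError hξ σ' t e := by
  have h := obsSpan_eq sys σ' ξ σ hk (t - 1)
  refine ⟨h ▸ he.orth, ?_⟩
  rw [h]
  convert he.sub.add (sub_mem_obsSpan sys σ ξ σ' hk t).1 using 2
  abel

-- Abstract projection, with no invertibility of the innovation covariances. The sufficiency and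
-- optimality statements use these errors and never the Kalman recursion.
variable (hξ σ) in
theorem exists_isPredError (hk : 1 ≤ k) (ht : t ≤ T + 1) : ∃ e, IsPredError hξ σ t e := by
  obtain ⟨e, he, hs⟩ := hξ.isGaussianSpace.exists_sub_inSpan_of_fg (obsSpan_fg sys σ ξ (t - 1))
    (obsSpan_le_univ sys σ ξ hk (by omega))
    ((inSpan_past_X (sys := sys) (σ := σ) (ξ := ξ) hk ht le_rfl le_rfl).mono (primSpan_le_univ ξ _))
  exact ⟨e, he, hs⟩

/-- The predictor is a linear function of the observations. -/
theorem IsPredError.pred_eq [IsProbabilityMeasure μ] (hk : 1 ≤ k) (ht : t ≤ T + 1)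
    (he : IsPredError hξ σ t e) :
    pred sys σ ξ μ t =ᵐ[μ] fun ω => X sys σ ξ t ω - e ω := by
  have hle := obsSpan_le_univ (T := T) sys σ ξ hk (r := t - 1) (by omega)
  exact hξ.isGaussianSpace.condExp_eq he.orth (obsVec_mem sys σ ξ hk (t - 1)) hle
    (info_le_comap sys σ ξ (t - 1)) (by simp) (measurable_of_inSpan_obsSpan sys σ ξ he.sub)
    (he.sub.mono hle)

theorem IsPredError.condSecondMoment_eq [IsProbabilityMeasure μ] (hk : 1 ≤ k) (ht : t ≤ T + 1)
    (he : IsPredError hξ σ t e) :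
    condSecondMoment μ (info sys σ ξ (t - 1)) (fun ω => X sys σ ξ t ω - pred sys σ ξ μ t ω)
      =ᵐ[μ] fun _ => crossMoment μ e e := by
  have hle := obsSpan_le_univ (T := T) sys σ ξ hk (r := t - 1) (by omega)
  refine hξ.isGaussianSpace.condSecondMoment_eq he.orth (obsVec_mem sys σ ξ hk (t - 1)) hle
    (info_le_comap sys σ ξ (t - 1)) ?_
  filter_upwards [he.pred_eq hk ht] with ω hω
  rw [hω]
  abel

variable (hξ σ) in
theorem isPredError_one (hk : 1 ≤ k) : IsPredError hξ σ 1 (fun ω => (ξ ω).x1) where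
  orth := by
    intro a
    refine hξ.isGaussianSpace.mem_orth_span (primSpan_le_univ ξ (past n T 0 0) (inSpan_x1 ξ a))
      ?_ ?_ <;> simp
  sub := by
    rw [X_one sys σ ξ hk]
    convert InSpan.zero (S := obsSpan sys σ ξ (1 - 1)) using 2
    exact sub_self _

theorem pred_one [IsProbabilityMeasure μ] (hk : 1 ≤ k) (hξ : IsPrimitive sys T μ ξ)
    (σ : Strategy dy du k) : pred sys σ ξ μ 1 =ᵐ[μ] 0 := by
  filter_upwards [(isPredError_one hξ σ hk).pred_eq hk (by omega)] with ω hω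
  rw [hω, X_one sys σ ξ hk]
  exact sub_self _

/-- The innovation `Y_t - C_t X̂_{t|t-1}`, for a prediction error `e`. -/
def innovation (sys : LQGSystem dx dy du) (ξ : Ω → Noise dx dy) (t : ℕ) (e : Ω → Fin dx → ℝ) :
    Ω → Stack dy → ℝ :=
  fun ω => sys.C t *ᵥ e ω + fun p => (ξ ω).wi t p.1 p.2

/-- The update of the prediction error by the Kalman filter. -/
def nextPredError (sys : LQGSystem dx dy du) (ξ : Ω → Noise dx dy) (t : ℕ)
    (K : Matrix (Fin dx) (Stack dy) ℝ) (e : Ω → Fin dx → ℝ) : Ω → Fin dx → ℝ :=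
  fun ω => sys.A t *ᵥ e ω + (ξ ω).w0 t - K *ᵥ innovation sys ξ t e ω

/-- The Kalman filter: the update of a prediction error is a prediction error, and its covariance
is the next term of the Riccati recursion. -/
theorem IsPredError.next (hk : 1 ≤ k) (ht1 : 1 ≤ t) (ht : t ≤ T) (he : IsPredError hξ σ t e)
    (hP : crossMoment μ e e = riccati sys t) (hdet : IsUnit (innovCov sys t).det) :
    IsPredError hξ σ (t + 1) (nextPredError sys ξ t (kalmanGain sys t (riccati sys t)) e) ∧
      crossMoment μ (nextPredError sys ξ t (kalmanGain sys t (riccati sys t)) e)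
        (nextPredError sys ξ t (kalmanGain sys t (riccati sys t)) e) = riccati sys (t + 1) := by
  set K := kalmanGain sys t (riccati sys t) with hK
  set ν := innovation sys ξ t e with hν
  set e' := nextPredError sys ξ t K e with he'
  have hG := hξ.isGaussianSpace
  have hobs := obsSpan_le_past sys σ ξ hk (T := T) (r := t - 1) (a := t) (b := t)
    (by omega) (by omega) (by omega)
  have hobs' := obsSpan_le_univ (T := T) sys σ ξ hk (r := t - 1) (by omega)
  have hep : InSpan (primSpan ξ (past n T t t)) e := by
    convert (inSpan_past_X (σ := σ) hk (by omega) le_rfl le_rfl).sub (he.sub.mono hobs) using 2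
    abel
  have heE : InSpan (primSpan ξ Set.univ) e := he.orth.mono hG.orth_le
  -- the noises
  have hw0o := hξ.w0_mem_orth (a := t) (b := t + 1) ht1 ht le_rfl
  have hwio := hξ.wi_mem_orth (a := t) (b := t) ht1 ht le_rfl
  have hw0E := hw0o.mono hG.orth_le
  have hwiE := hwio.mono hG.orth_le
  have hν1 : InSpan (hG.orth (obsSpan sys σ ξ (t - 1))) ν :=
    (he.orth.mulVec _).add (hwio.mono (hG.orth_anti hobs))
  have hνE := hν1.mono hG.orth_le
  have hobs2 := obsSpan_le_past sys σ ξ hk (T := T) (r := t - 1) (a := t) (b := t + 1)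
    (by omega) (by omega) (by omega)
  have hd1 : InSpan (hG.orth (obsSpan sys σ ξ (t - 1))) (fun ω => sys.A t *ᵥ e ω + (ξ ω).w0 t) :=
    (he.orth.mulVec _).add (hw0o.mono (hG.orth_anti hobs2))
  have hdE := hd1.mono hG.orth_le
  have he'1 : InSpan (hG.orth (obsSpan sys σ ξ (t - 1))) e' := hd1.sub (hν1.mulVec K)
  have he'E := he'1.mono hG.orth_le
  -- moments
  have m1 : crossMoment μ e (fun ω (p : Stack dy) => (ξ ω).wi t p.1 p.2) = 0 := by
    rw [← IsGaussianSpace.crossMoment_transpose,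
      hG.crossMoment_orth hwio hep (primSpan_le_univ ξ _), transpose_zero]
  have m2 : crossMoment μ (fun ω => (ξ ω).w0 t) e = 0 :=
    hG.crossMoment_orth hw0o (hep.mono (primSpan_mono ξ (past_mono le_rfl (by omega))))
      (primSpan_le_univ ξ _)
  have m2' : crossMoment μ e (fun ω => (ξ ω).w0 t) = 0 := by
    rw [← IsGaussianSpace.crossMoment_transpose, m2, transpose_zero]
  have m3 := hξ.crossMoment_w0_wi ht1 ht ht1 ht
  have m4 := hξ.crossMoment_wi ht1 ht
  have m5 := hξ.crossMoment_w0 ht1 ht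
  have m1' : crossMoment μ (fun ω (p : Stack dy) => (ξ ω).wi t p.1 p.2) e = 0 := by
    rw [← IsGaussianSpace.crossMoment_transpose, m1, transpose_zero]
  have meν : crossMoment μ e ν = riccati sys t * (sys.C t)ᵀ := by
    rw [hν]
    unfold innovation
    rw [hG.crossMoment_add_right heE (heE.mulVec _) hwiE, hG.crossMoment_mulVec_right _ heE heE,
      hP, m1, add_zero]
  have mwν : crossMoment μ (fun ω (p : Stack dy) => (ξ ω).wi t p.1 p.2) ν = sys.covW := by
    rw [hν]
    unfold innovation
    rw [hG.crossMoment_add_right hwiE (heE.mulVec _) hwiE, hG.crossMoment_mulVec_right _ hwiE heE,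
      m1', m4, Matrix.zero_mul, zero_add]
  have m0ν : crossMoment μ (fun ω => (ξ ω).w0 t) ν = 0 := by
    rw [hν]
    unfold innovation
    rw [hG.crossMoment_add_right hw0E (heE.mulVec _) hwiE, hG.crossMoment_mulVec_right _ hw0E heE,
      m2, m3, Matrix.zero_mul, zero_add]
  have mνν : crossMoment μ ν ν = innovCov sys t := by
    have : crossMoment μ ν ν = crossMoment μ
        (fun ω => sys.C t *ᵥ e ω + fun p => (ξ ω).wi t p.1 p.2) ν := rfl
    rw [this, hG.crossMoment_add_left (heE.mulVec _) hwiE hνE,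
      hG.crossMoment_mulVec_left _ heE hνE, meν, mwν, innovCov, Matrix.mul_assoc]
  have mdν : crossMoment μ (fun ω => sys.A t *ᵥ e ω + (ξ ω).w0 t) ν =
      sys.A t * riccati sys t * (sys.C t)ᵀ := by
    rw [hG.crossMoment_add_left (heE.mulVec _) hw0E hνE, hG.crossMoment_mulVec_left _ heE hνE,
      meν, m0ν, add_zero, Matrix.mul_assoc]
  -- The normal equation that determines the Kalman gain: the new error must be uncorrelated with
  -- the innovation. Invertibility of the innovation covariance is used only here.
  have mKν : crossMoment μ e' ν = 0 := by
    have : crossMoment μ e' ν = crossMoment μ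
        (fun ω => sys.A t *ᵥ e ω + (ξ ω).w0 t - K *ᵥ ν ω) ν := rfl
    rw [this, hG.crossMoment_sub_left hdE (hνE.mulVec K) hνE, hG.crossMoment_mulVec_left _ hνE hνE,
      mdν, mνν, hK, kalmanGain, ← innovCov, Matrix.mul_assoc _ _ (innovCov sys t),
      Matrix.nonsing_inv_mul _ hdet, Matrix.mul_one, sub_self]
  have hYν : Y sys σ ξ t = fun ω => sys.C t *ᵥ (X sys σ ξ t ω - e ω) + ν ω := by
    rw [Y_eq sys σ ξ hk ht1]
    funext ω
    simp only [hν, innovation, mulVec_sub]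
    abel
  have hνs : InSpan (obsSpan sys σ ξ t) ν := by
    convert (Y_mem_obsSpan sys σ ξ (le_refl t)).sub
      ((he.sub.mono (obsSpan_mono sys σ ξ (by omega : t - 1 ≤ t))).mulVec (sys.C t)) using 2
    rw [hYν]
    exact (add_sub_cancel_left _ _).symm
  refine ⟨⟨?_, ?_⟩, ?_⟩
  · intro i
    refine hG.mem_orth_span (he'E i) ?_ ?_
    · rintro _ ⟨s, hs, p, rfl⟩
      have := mem_Icc.1 hs
      exact primSpan_le_univ ξ _ (inSpan_past_Y (σ := σ) hk (by omega : s ≤ T) le_rfl le_rfl p)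
    · rintro _ ⟨s, hs, p, rfl⟩
      have hs' := mem_Icc.1 hs
      -- Older observations are orthogonal to every term of `e'`; the newest one is a function of
      -- the older ones plus the innovation.
      have h0 : crossMoment μ e' (Y sys σ ξ s) = 0 := by
        rcases Nat.lt_or_ge s t with h | h
        · exact hG.crossMoment_orth he'1 (Y_mem_obsSpan sys σ ξ (by omega)) hobs'
        · obtain rfl : s = t := by omega
          rw [hYν, hG.crossMoment_add_right he'E ((he.sub.mono hobs').mulVec _) hνE, mKν,
            hG.crossMoment_orth he'1 (he.sub.mulVec _) hobs', add_zero]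
      exact congrFun (congrFun h0 i) p
  · have hX : (fun ω => X sys σ ξ (t + 1) ω - e' ω) = fun ω =>
        sys.A t *ᵥ (X sys σ ξ t ω - e ω) + sys.B t *ᵥ U sys σ ξ t ω + K *ᵥ ν ω := by
      rw [X_succ sys σ ξ hk ht1]
      funext ω
      simp only [he', nextPredError, mulVec_sub]
      abel
    rw [hX]
    exact (((he.sub.mono (obsSpan_mono sys σ ξ (by omega : t - 1 ≤ t))).mulVec _).add
      ((U_mem_obsSpan sys σ ξ hk le_rfl).mulVec _)).add (hνs.mulVec _)
  -- As `e'` is uncorrelated with `ν`, its second moment equals its cross moment with `A e + W⁰`;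
  -- this leaves the single correction term of the Riccati recursion.
  · have h1 : crossMoment μ e' e' = crossMoment μ e'
        (fun ω => sys.A t *ᵥ e ω + (ξ ω).w0 t - K *ᵥ ν ω) := rfl
    have h2 : crossMoment μ e' (fun ω => sys.A t *ᵥ e ω + (ξ ω).w0 t) = crossMoment μ
        (fun ω => sys.A t *ᵥ e ω + (ξ ω).w0 t - K *ᵥ ν ω)
        (fun ω => sys.A t *ᵥ e ω + (ξ ω).w0 t) := rfl
    have mνd : crossMoment μ ν (fun ω => sys.A t *ᵥ e ω + (ξ ω).w0 t) =
        sys.C t * riccati sys t * (sys.A t)ᵀ := by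
      have hsym : (riccati sys t)ᵀ = riccati sys t := by
        rw [← hP, IsGaussianSpace.crossMoment_transpose]
      rw [← IsGaussianSpace.crossMoment_transpose, mdν]
      simp only [transpose_mul, transpose_transpose, hsym, Matrix.mul_assoc]
    obtain ⟨s, rfl⟩ := Nat.exists_eq_add_of_le' ht1
    rw [h1, hG.crossMoment_sub_right he'E hdE (hνE.mulVec K),
      hG.crossMoment_mulVec_right _ he'E hνE, mKν, Matrix.zero_mul, sub_zero, h2,
      hG.crossMoment_sub_left hdE (hνE.mulVec K) hdE, hG.crossMoment_mulVec_left _ hνE hdE, mνd,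
      hG.crossMoment_add_right hdE (heE.mulVec _) hw0E, hG.crossMoment_mulVec_right _ hdE heE,
      hG.crossMoment_add_left (heE.mulVec _) hw0E heE, hG.crossMoment_mulVec_left _ heE heE,
      hG.crossMoment_add_left (heE.mulVec _) hw0E hw0E, hG.crossMoment_mulVec_left _ heE hw0E,
      m2, m2', m5, hP, hK]
    have hr : riccati sys (s + 1 + 1) = sys.A (s + 1) * riccati sys (s + 1) * (sys.A (s + 1))ᵀ +
      sys.covW0 - kalmanGain sys (s + 1) (riccati sys (s + 1)) * sys.C (s + 1) *
        riccati sys (s + 1) * (sys.A (s + 1))ᵀ := rfl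
    rw [hr]
    simp only [Matrix.mul_zero, add_zero, zero_add, Matrix.mul_assoc]

variable (hξ σ) in
theorem exists_isPredError_riccati (hk : 1 ≤ k)
    (hdet : ∀ t ∈ Icc 1 T, IsUnit (innovCov sys t).det) (t : ℕ) (ht1 : 1 ≤ t) (ht : t ≤ T + 1) :
    ∃ e, IsPredError hξ σ t e ∧ crossMoment μ e e = riccati sys t := by
  induction t, ht1 using Nat.le_induction with
  | base => exact ⟨_, isPredError_one hξ σ hk, hξ.crossMoment_x1⟩
  | succ t ht1 ih =>
    obtain ⟨e, he, hP⟩ := ih (by omega)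
    exact ⟨_, he.next hk ht1 (by omega) hP (hdet t (mem_Icc.2 ⟨ht1, by omega⟩))⟩

/-- The Kalman recursion for the predictor. -/
theorem pred_succ [IsProbabilityMeasure μ] (hk : 1 ≤ k) (hξ : IsPrimitive sys T μ ξ)
    (σ : Strategy dy du k) (hdet : ∀ t ∈ Icc 1 T, IsUnit (innovCov sys t).det)
    (ht1 : 1 ≤ t) (ht : t ≤ T) :
    pred sys σ ξ μ (t + 1) =ᵐ[μ] fun ω =>
      sys.A t *ᵥ pred sys σ ξ μ t ω + sys.B t *ᵥ U sys σ ξ t ω +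
        kalmanGain sys t (riccati sys t) *ᵥ (Y sys σ ξ t ω - sys.C t *ᵥ pred sys σ ξ μ t ω) := by
  obtain ⟨e, he, hP⟩ := exists_isPredError_riccati hξ σ hk hdet t ht1 (by omega)
  have h := (he.next hk ht1 ht hP (hdet t (mem_Icc.2 ⟨ht1, ht⟩))).1
  filter_upwards [he.pred_eq hk (by omega), h.pred_eq hk (by omega)] with ω h1 h2
  rw [h1, h2, X_succ sys σ ξ hk ht1, Y_eq sys σ ξ hk ht1]
  simp only [nextPredError, innovation, mulVec_sub, mulVec_add]
  abel

end

/-! ### Sufficiency of the statistic -/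

section Statistic

variable {n dx k T : ℕ} {dy du : Fin n → ℕ} {sys : LQGSystem dx dy du}
  {Ω : Type*} {mΩ : MeasurableSpace Ω} {μ : Measure Ω} {ξ : Ω → Noise dx dy}

/-- The statistic `S_t`, with the predictor written as the state minus a prediction error. -/
def linStat (sys : LQGSystem dx dy du) (σ : Strategy dy du k) (ξ : Ω → Noise dx dy)
    (e : ℕ → Ω → Fin dx → ℝ) (t : ℕ) (ω : Ω) : StatIdx dx dy du k → ℝ :=
  Sum.elim (X sys σ ξ (t + 1 - k) ω - e (t + 1 - k) ω)
    (Sum.elim (fun p => Ut sys σ ξ (t - 1 - p.1) ω p.2)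
      (fun p => Sum.elim (Y sys σ ξ (t - k - p.1) ω) (U sys σ ξ (t - k - p.1) ω) p.2))

/-- A sequence of prediction errors, up to the horizon. -/
def ArePredErrors (hξ : IsPrimitive sys T μ ξ) (σ : Strategy dy du k) (e : ℕ → Ω → Fin dx → ℝ) :
    Prop := ∀ t ≤ T + 1, IsPredError hξ σ t (e t)

variable {hξ : IsPrimitive sys T μ ξ} {σ : Strategy dy du k} {e : ℕ → Ω → Fin dx → ℝ}

theorem ArePredErrors.change (hk : 1 ≤ k) (he : ArePredErrors hξ σ e) (σ' : Strategy dy du k) :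
    ArePredErrors hξ σ' e := fun t ht => (he t ht).change hk σ'

variable (hξ σ) in
theorem exists_arePredErrors (hk : 1 ≤ k) : ∃ e, ArePredErrors hξ σ e := by
  have h : ∀ t, ∃ e, t ≤ T + 1 → IsPredError hξ σ t e := by
    intro t
    by_cases ht : t ≤ T + 1
    · obtain ⟨e, he⟩ := exists_isPredError hξ σ hk ht
      exact ⟨e, fun _ => he⟩
    · exact ⟨fun _ => 0, fun h => absurd h ht⟩
  choose e he using h
  exact ⟨e, he⟩

theorem linStat_mem_obsSpan (hk : 1 ≤ k) (he : ArePredErrors hξ σ e) {t : ℕ} (ht : t ≤ T) :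
    InSpan (obsSpan sys σ ξ (t - k)) (linStat sys σ ξ e t) := by
  rintro (i | ⟨p, a⟩ | ⟨p, a | a⟩)
  · have h := (he (t + 1 - k) (by omega)).sub
    rw [show t + 1 - k - 1 = t - k by omega] at h
    exact h i
  · exact Ut_mem_obsSpan sys σ ξ hk (by omega : t - 1 - (p : ℕ) - k ≤ t - k) a
  · exact Y_mem_obsSpan sys σ ξ (by omega : t - k - (p : ℕ) ≤ t - k) a
  · exact U_mem_obsSpan sys σ ξ hk (by omega : t - k - (p : ℕ) ≤ t - k) a

/-- The predictor is determined only almost everywhere, whereas the linear algebra in `K` and `ω`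
below is pointwise; this is the bridge between the two. -/
theorem stat_eq_linStat [IsProbabilityMeasure μ] (hk : 1 ≤ k) (he : ArePredErrors hξ σ e) {t : ℕ}
    (ht : t ≤ T) : stat sys σ ξ μ t =ᵐ[μ] linStat sys σ ξ e t := by
  filter_upwards [(he (t + 1 - k) (by omega)).pred_eq hk (by omega)] with ω hω
  unfold stat linStat
  rw [hω]

/-- The random variables, indexed by the gains `K` on the shared memory, that are the sum of a fixed
linear function of the statistic `S_t` and of a fixed random variable that is uncorrelated with the
shared memory. -/
def statSpan (hξ : IsPrimitive sys T μ ξ) (G : ObsGain dy du) (H : MemGain dy du k)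
    (e : ℕ → Ω → Fin dx → ℝ) (t : ℕ) : Submodule ℝ (SharedGain dy du k × Ω → ℝ) where
  carrier := {φ | ∃ c : StatIdx dx dy du k → ℝ,
    ∃ η ∈ hξ.isGaussianSpace.orth (obsSpan sys ⟨0, G, H⟩ ξ (t - k)),
      ∀ K ω, φ (K, ω) = c ⬝ᵥ linStat sys ⟨K, G, H⟩ ξ e t ω + η ω}
  add_mem' := by
    rintro φ ψ ⟨c, η, hη, h⟩ ⟨d, θ, hθ, h'⟩
    refine ⟨c + d, η + θ, Submodule.add_mem _ hη hθ, fun K ω => ?_⟩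
    rw [Pi.add_apply, h, h', add_dotProduct, Pi.add_apply]
    ring
  zero_mem' := ⟨0, 0, Submodule.zero_mem _, fun K ω => by simp⟩
  smul_mem' := by
    rintro r φ ⟨c, η, hη, h⟩
    refine ⟨r • c, r • η, Submodule.smul_mem _ r hη, fun K ω => ?_⟩
    rw [Pi.smul_apply, h, smul_dotProduct, Pi.smul_apply, smul_add]

variable {G : ObsGain dy du} {H : MemGain dy du k}

theorem linStat_mem_statSpan (t : ℕ) : InSpan (statSpan hξ G H e t)
    (fun p => linStat sys ⟨p.1, G, H⟩ ξ e t p.2) :=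
  fun i => ⟨Pi.single i 1, 0, Submodule.zero_mem _, fun K ω => by simp⟩

theorem orth_mem_statSpan {ι : Type*} {t : ℕ} {η : Ω → ι → ℝ}
    (hη : InSpan (hξ.isGaussianSpace.orth (obsSpan sys ⟨0, G, H⟩ ξ (t - k))) η) :
    InSpan (statSpan hξ G H e t) (fun p => η p.2) :=
  fun i => ⟨0, _, hη i, fun K ω => by simp⟩

theorem M_mem_statSpan {t s : ℕ}
    (hY : ∀ r, r + k ≥ s + 1 ∨ r = 0 → r ≤ s - 1 →
      InSpan (statSpan hξ G H e t) (fun p => Y sys ⟨p.1, G, H⟩ ξ r p.2))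
    (hU : ∀ r, r + k ≥ s + 1 ∨ r = 0 → r ≤ s - 1 →
      InSpan (statSpan hξ G H e t) (fun p => U sys ⟨p.1, G, H⟩ ξ r p.2)) :
    InSpan (statSpan hξ G H e t) (fun p => M sys ⟨p.1, G, H⟩ ξ s p.2) := by
  rintro ⟨i, j, a | b⟩
  · exact hY (s - 1 - j) (by omega) (by omega) ⟨i, a⟩
  · exact hU (s - 1 - j) (by omega) (by omega) ⟨i, b⟩

theorem w0_mem_orth_obsSpan (hk : 1 ≤ k) {r t : ℕ} (h1 : 1 ≤ t) (ht : t ≤ T) (hr : r ≤ t) :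
    InSpan (hξ.isGaussianSpace.orth (obsSpan sys σ ξ r)) (fun ω => (ξ ω).w0 t) :=
  (hξ.w0_mem_orth (a := t) (b := t + 1) h1 ht le_rfl).mono
    (hξ.isGaussianSpace.orth_anti (obsSpan_le_past sys σ ξ hk (by omega) hr (by omega)))

theorem wi_mem_orth_obsSpan (hk : 1 ≤ k) {r t : ℕ} (h1 : 1 ≤ t) (ht : t ≤ T) (hr : r < t) :
    InSpan (hξ.isGaussianSpace.orth (obsSpan sys σ ξ r))
      (fun ω (p : Stack dy) => (ξ ω).wi t p.1 p.2) :=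
  (hξ.wi_mem_orth (a := t) (b := t) h1 ht le_rfl).mono
    (hξ.isGaussianSpace.orth_anti (obsSpan_le_past sys σ ξ hk (by omega) hr.le hr))

/-- Functions on gains times `Ω` turn "with coefficients free of `K`" into membership in a linear
space, so the recursion can be run inside `statSpan`. It starts from `X_{t-k+1}`, the predictor plus
an error; the later noise is newer than the shared memory and the later `Ũ_s` are entries of `S_t`.
For `s > t - k` the memory `M_s` reaches back to `s - k + 1 ≥ t - 2k + 2`, the start of the window
of old signals in `S_t`. `U_t` is excluded since `Ũ_t` is not part of `S_t`. -/
theorem mem_statSpan (hk : 1 ≤ k) (he : ArePredErrors hξ ⟨0, G, H⟩ e) {t : ℕ} (ht : t ≤ T)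
    (s : ℕ) (hst : s ≤ t) :
    (t - k < s → InSpan (statSpan hξ G H e t) (fun p => X sys ⟨p.1, G, H⟩ ξ s p.2)) ∧
    (s + 2 * k ≥ t + 2 ∨ s = 0 →
      InSpan (statSpan hξ G H e t) (fun p => Y sys ⟨p.1, G, H⟩ ξ s p.2)) ∧
    (s + 2 * k ≥ t + 2 ∨ s = 0 → s < t →
      InSpan (statSpan hξ G H e t) (fun p => U sys ⟨p.1, G, H⟩ ξ s p.2)) := by
  induction s using Nat.strong_induction_on with
  | _ s ih =>
  rcases Nat.eq_zero_or_pos s with rfl | hs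
  · exact ⟨fun h => absurd h (by omega), fun _ => InSpan.zero, fun _ _ => InSpan.zero⟩
  have hL := linStat_mem_statSpan (hξ := hξ) (G := G) (H := H) (e := e) t
  rcases Nat.lt_or_ge (t - k) s with hsk | hsk
  · have hX : InSpan (statSpan hξ G H e t) (fun p => X sys ⟨p.1, G, H⟩ ξ s p.2) := by
      rcases Nat.lt_or_ge (t - k + 1) s with h1 | h1
      · obtain ⟨s, rfl⟩ := Nat.exists_eq_add_of_le' hs
        have h2 := ((((ih s (by omega) (by omega)).1 (by omega)).mulVec (sys.A s)).add
          (((ih s (by omega) (by omega)).2.2 (by omega) (by omega)).mulVec (sys.B s))).add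
          (orth_mem_statSpan (w0_mem_orth_obsSpan (hξ := hξ) hk (by omega : 1 ≤ s) (by omega)
            (by omega : t - k ≤ s)))
        convert h2 using 2 with p
        rw [X_succ sys _ ξ hk (by omega)]
      · obtain rfl : s = t - k + 1 := by omega
        -- For `t < k` the predictor in `S_t` carries the truncated index `0` instead of `1`; but
        -- then nothing is shared yet, and `X_1` itself is the residual.
        rcases Nat.lt_or_ge t k with h3 | h3
        · have h0 : t - k = 0 := by omega
          have h2 := orth_mem_statSpan (hξ := hξ) (G := G) (H := H) (t := t) (e := e)
            (by rw [h0]; exact (isPredError_one hξ ⟨0, G, H⟩ hk).orth)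
          convert h2 using 2 with p
          rw [h0, zero_add, X_one sys _ ξ hk]
        · have h4 := (he (t - k + 1) (by omega)).orth
          have h2 := InSpan.add (fun i => hL (Sum.inl i)) (orth_mem_statSpan h4)
          convert h2 using 2 with p
          funext i
          simp only [linStat, Sum.elim_inl, Pi.add_apply, Pi.sub_apply,
            show t + 1 - k = t - k + 1 by omega, sub_add_cancel]
    have hY : InSpan (statSpan hξ G H e t) (fun p => Y sys ⟨p.1, G, H⟩ ξ s p.2) := by
      have h2 := (hX.mulVec (sys.C s)).add
        (orth_mem_statSpan (wi_mem_orth_obsSpan (hξ := hξ) hk hs (by omega) hsk))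
      convert h2 using 2 with p
      rw [Y_eq sys _ ξ hk hs]
    refine ⟨fun _ => hX, fun _ => hY, fun _ hlt => ?_⟩
    have hUt : InSpan (statSpan hξ G H e t) (fun p => Ut sys ⟨p.1, G, H⟩ ξ s p.2) := by
      intro b
      have h2 := hL (Sum.inr (Sum.inl (⟨t - 1 - s, by omega⟩, b)))
      simpa only [linStat, Sum.elim_inr, Sum.elim_inl, show t - 1 - (t - 1 - s) = s by omega]
        using h2
    have h2 := (hUt.add (hY.mulVec (G.diag s))).add ((M_mem_statSpan (s := s)
      (fun r hr hr' => (ih r (by omega) (by omega)).2.1 (by omega))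
      (fun r hr hr' => (ih r (by omega) (by omega)).2.2 (by omega) (by omega))).mulVec (H.diag s))
    convert h2 using 2 with p
    rw [U_eq sys _ ξ hk hs]
  · refine ⟨fun h => absurd h (by omega), fun h a => ?_, fun h _ a => ?_⟩
    · have h2 := hL (Sum.inr (Sum.inr (⟨t - k - s, by omega⟩, Sum.inl a)))
      simpa only [linStat, Sum.elim_inr, Sum.elim_inl, show t - k - (t - k - s) = s by omega]
        using h2
    · have h2 := hL (Sum.inr (Sum.inr (⟨t - k - s, by omega⟩, Sum.inr a)))
      simpa only [linStat, Sum.elim_inr, Sum.elim_inl, show t - k - (t - k - s) = s by omega]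
        using h2

/-- `vec(X_t, M_t)` is the sum of a linear function of `S_t` and of a random vector that is
uncorrelated with the shared memory, neither of which depends on the gains `K`. -/
theorem exists_stateMem_eq (hk : 1 ≤ k) (he : ArePredErrors hξ ⟨0, G, H⟩ e) {t : ℕ} (ht1 : 1 ≤ t)
    (ht : t ≤ T) : ∃ (Λ : Matrix (EstIdx dx dy du k) (StatIdx dx dy du k) ℝ)
      (η : Ω → EstIdx dx dy du k → ℝ),
      InSpan (hξ.isGaussianSpace.orth (obsSpan sys ⟨0, G, H⟩ ξ (t - k))) η ∧
      ∀ (K : SharedGain dy du k) ω,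
        Sum.elim (X sys ⟨K, G, H⟩ ξ t ω) (M sys ⟨K, G, H⟩ ξ t ω) =
          Λ *ᵥ linStat sys ⟨K, G, H⟩ ξ e t ω + η ω := by
  have h := InSpan.elim ((mem_statSpan hk he ht t le_rfl).1 (by omega))
    (M_mem_statSpan (s := t)
      (fun r hr hr' => (mem_statSpan hk he ht r (by omega)).2.1 (by omega))
      (fun r hr hr' => (mem_statSpan hk he ht r (by omega)).2.2 (by omega) (by omega)))
  choose c η hη hc using h
  exact ⟨Matrix.of c, fun ω i => η i ω, hη, fun K ω => funext fun i => hc i K ω⟩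

/-- The error of the estimate of `vec(X_t, Y_t, M_t)`, for the error `η` of the estimate of
`vec(X_t, M_t)`. -/
def coordErr (sys : LQGSystem dx dy du) (ξ : Ω → Noise dx dy) (t : ℕ)
    (η : Ω → EstIdx dx dy du k → ℝ) : Ω → CoordIdx dx dy du k → ℝ :=
  fun ω => embed sys k t *ᵥ η ω + Sum.elim (0 : Fin dx → ℝ)
    (Sum.elim (fun p => (ξ ω).wi t p.1 p.2) (0 : MemIdx dy du k → ℝ))

/-- As `k ≥ 1`, the sensor noise at `t` is newer than all shared observations, so it belongs
entirely to the error. -/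
theorem coordErr_mem_orth (hk : 1 ≤ k) {t : ℕ} (ht1 : 1 ≤ t) (ht : t ≤ T)
    {η : Ω → EstIdx dx dy du k → ℝ}
    (hη : InSpan (hξ.isGaussianSpace.orth (obsSpan sys σ ξ (t - k))) η) :
    InSpan (hξ.isGaussianSpace.orth (obsSpan sys σ ξ (t - k))) (coordErr sys ξ t η) := by
  refine (hη.mulVec _).add ?_
  rintro (i | p | i)
  · exact Submodule.zero_mem _
  · exact wi_mem_orth_obsSpan (hξ := hξ) (σ := σ) hk ht1 ht (by omega : t - k < t) p
  · exact Submodule.zero_mem _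

theorem embed_mulVec (t : ℕ) (x : Fin dx → ℝ) (m : MemIdx dy du k → ℝ) :
    embed sys k t *ᵥ Sum.elim x m = Sum.elim x (Sum.elim (sys.C t *ᵥ x) m) := by
  simp only [embed, fromRows_mulVec, fromCols_mulVec, Sum.elim_comp_inl, Sum.elim_comp_inr,
    one_mulVec, zero_mulVec, add_zero, zero_add]

theorem coordState_eq (hk : 1 ≤ k) {t : ℕ} (ht1 : 1 ≤ t)
    {Λ : Matrix (EstIdx dx dy du k) (StatIdx dx dy du k) ℝ} {η : Ω → EstIdx dx dy du k → ℝ} {ω : Ω}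
    (h : Sum.elim (X sys σ ξ t ω) (M sys σ ξ t ω) = Λ *ᵥ linStat sys σ ξ e t ω + η ω) :
    coordState sys σ ξ t ω =
      (embed sys k t * Λ) *ᵥ linStat sys σ ξ e t ω + coordErr sys ξ t η ω := by
  rw [coordErr, ← mulVec_mulVec, ← add_assoc, ← mulVec_add, ← h, embed_mulVec, coordState,
    Y_eq sys σ ξ hk ht1]
  funext i
  rcases i with i | i | i <;> simp

theorem stateMemEst_eq [IsProbabilityMeasure μ] (hk : 1 ≤ k) (he : ArePredErrors hξ σ e) {t : ℕ}
    (ht : t ≤ T) {Λ : Matrix (EstIdx dx dy du k) (StatIdx dx dy du k) ℝ}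
    {η : Ω → EstIdx dx dy du k → ℝ}
    (hη : InSpan (hξ.isGaussianSpace.orth (obsSpan sys σ ξ (t - k))) η)
    (h : ∀ ω, Sum.elim (X sys σ ξ t ω) (M sys σ ξ t ω) = Λ *ᵥ linStat sys σ ξ e t ω + η ω) :
    stateMemEst sys σ ξ μ t =ᵐ[μ] fun ω => Λ *ᵥ stat sys σ ξ μ t ω := by
  have hle := obsSpan_le_univ (T := T) sys σ ξ hk (r := t - k) (by omega)
  have hS := (linStat_mem_obsSpan hk he ht).mulVec Λ
  have h1 : stateMemEst sys σ ξ μ t =ᵐ[μ] fun ω => Λ *ᵥ linStat sys σ ξ e t ω := by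
    unfold stateMemEst
    rw [coordInfo_eq sys σ ξ hk]
    exact hξ.isGaussianSpace.condExp_eq hη (obsVec_mem sys σ ξ hk (t - k)) hle
      (info_le_comap sys σ ξ (t - k)) (funext h) (measurable_of_inSpan_obsSpan sys σ ξ hS)
      (hS.mono hle)
  filter_upwards [h1, stat_eq_linStat hk he ht] with ω h1 h2
  rw [h1, h2]

theorem condSecondMoment_coordErr [IsProbabilityMeasure μ] (hk : 1 ≤ k)
    (he : ArePredErrors hξ σ e) {t : ℕ}
    (ht : t ≤ T) {L : Matrix (CoordIdx dx dy du k) (StatIdx dx dy du k) ℝ}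
    {η : Ω → CoordIdx dx dy du k → ℝ}
    (hη : InSpan (hξ.isGaussianSpace.orth (obsSpan sys σ ξ (t - k))) η)
    (h : ∀ ω, coordState sys σ ξ t ω = L *ᵥ linStat sys σ ξ e t ω + η ω) :
    condSecondMoment μ (coordInfo sys σ ξ t)
      (fun ω => coordState sys σ ξ t ω - coordEst sys σ ξ μ t ω)
      =ᵐ[μ] fun _ => crossMoment μ η η := by
  have hle := obsSpan_le_univ (T := T) sys σ ξ hk (r := t - k) (by omega)
  have hS := (linStat_mem_obsSpan hk he ht).mulVec L
  unfold coordEst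
  rw [coordInfo_eq sys σ ξ hk]
  have h1 := hξ.isGaussianSpace.condExp_eq hη (obsVec_mem sys σ ξ hk (t - k)) hle
      (info_le_comap sys σ ξ (t - k)) (funext h) (measurable_of_inSpan_obsSpan sys σ ξ hS)
      (hS.mono hle)
  refine hξ.isGaussianSpace.condSecondMoment_eq hη (obsVec_mem sys σ ξ hk (t - k)) hle
      (info_le_comap sys σ ξ (t - k)) ?_
  filter_upwards [h1] with ω h1
  rw [h1, h ω]
  exact add_sub_cancel_left _ _

end Statistic

/-! ### Completing the square in one Riccati step -/

section RiccatiStep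

variable {a b : Type*} [Fintype a] [Fintype b] [DecidableEq b]
  {A V Q : Matrix a a ℝ} {B N : Matrix a b ℝ} {R : Matrix b b ℝ}

omit [Fintype b] [DecidableEq b] in
theorem dotProduct_mulVec_comm {S : Matrix a a ℝ} (hS : Sᵀ = S) (x y : a → ℝ) :
    x ⬝ᵥ S *ᵥ y = y ⬝ᵥ S *ᵥ x := by
  rw [dotProduct_mulVec, ← mulVec_transpose, hS, dotProduct_comm]

omit [DecidableEq b] in
theorem mulVec_dotProduct_eq (C : Matrix a b ℝ) (x : b → ℝ) (y : a → ℝ) :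
    (C *ᵥ x) ⬝ᵥ y = x ⬝ᵥ Cᵀ *ᵥ y := by
  rw [dotProduct_mulVec, vecMul_transpose]

/-- One step of the Riccati recursion completes the square. -/
theorem riccati_step (hV : Vᵀ = V) (hR : Rᵀ = R) (hD : IsUnit (R + Bᵀ * V * B).det)
    (x : a → ℝ) (u : b → ℝ) :
    x ⬝ᵥ Q *ᵥ x + 2 * (x ⬝ᵥ N *ᵥ u) + u ⬝ᵥ R *ᵥ u + (A *ᵥ x + B *ᵥ u) ⬝ᵥ V *ᵥ (A *ᵥ x + B *ᵥ u) =
      x ⬝ᵥ (Aᵀ * V * A + Q - (Nᵀ + Bᵀ * V * A)ᵀ * (R + Bᵀ * V * B)⁻¹ * (Nᵀ + Bᵀ * V * A)) *ᵥ x +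
      (u + (R + Bᵀ * V * B)⁻¹ *ᵥ (Nᵀ + Bᵀ * V * A) *ᵥ x) ⬝ᵥ (R + Bᵀ * V * B) *ᵥ
        (u + (R + Bᵀ * V * B)⁻¹ *ᵥ (Nᵀ + Bᵀ * V * A) *ᵥ x) := by
  set D := R + Bᵀ * V * B with hDdef
  set Γ := Nᵀ + Bᵀ * V * A with hΓ
  have hDs : Dᵀ = D := by
    simp only [hDdef, transpose_add, transpose_mul, transpose_transpose, hV, hR, Matrix.mul_assoc]
  set y := D⁻¹ *ᵥ Γ *ᵥ x with hy
  have hDy : D *ᵥ y = Γ *ᵥ x := by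
    rw [hy, mulVec_mulVec, Matrix.mul_nonsing_inv _ hD, one_mulVec]
  have h1 : x ⬝ᵥ (Γᵀ * D⁻¹ * Γ) *ᵥ x = y ⬝ᵥ Γ *ᵥ x := by
    rw [Matrix.mul_assoc, ← mulVec_mulVec, ← mulVec_mulVec, ← hy, ← mulVec_dotProduct_eq,
      dotProduct_comm]
  have h2 : u ⬝ᵥ Γ *ᵥ x = x ⬝ᵥ N *ᵥ u + (B *ᵥ u) ⬝ᵥ V *ᵥ (A *ᵥ x) := by
    rw [hΓ, add_mulVec, dotProduct_add, ← mulVec_dotProduct_eq, dotProduct_comm (N *ᵥ u),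
      mulVec_dotProduct_eq B, mulVec_mulVec, mulVec_mulVec, Matrix.mul_assoc]
  have h3 : u ⬝ᵥ D *ᵥ u = u ⬝ᵥ R *ᵥ u + (B *ᵥ u) ⬝ᵥ V *ᵥ (B *ᵥ u) := by
    rw [hDdef, add_mulVec, dotProduct_add, mulVec_dotProduct_eq B, mulVec_mulVec, mulVec_mulVec,
      Matrix.mul_assoc]
  have h4 : x ⬝ᵥ (Aᵀ * V * A) *ᵥ x = (A *ᵥ x) ⬝ᵥ V *ᵥ (A *ᵥ x) := by
    rw [mulVec_dotProduct_eq A, mulVec_mulVec, mulVec_mulVec, Matrix.mul_assoc]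
  simp only [mulVec_add, add_dotProduct, dotProduct_add, sub_mulVec, add_mulVec, dotProduct_sub,
    h1, h3, h4, hDy, h2, dotProduct_mulVec_comm hDs y u, dotProduct_mulVec_comm hV (A *ᵥ x)]
  ring

omit [DecidableEq b] in
theorem posDef_inputTerm (hV : V.PosSemidef) (hR : R.PosDef) : (R + Bᵀ * V * B).PosDef := by
  have h := hV.conjTranspose_mul_mul_same B
  rw [conjTranspose_eq_transpose_of_trivial] at h
  exact hR.add_posSemidef h

/-- The cost-to-go matrices are positive semidefinite. -/
theorem posSemidef_riccati_step (hV : V.PosSemidef) (hR : R.PosDef) (hQ : Qᵀ = Q)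
    (hQN : ∀ x u, 0 ≤ x ⬝ᵥ Q *ᵥ x + 2 * (x ⬝ᵥ N *ᵥ u) + u ⬝ᵥ R *ᵥ u) :
    (Aᵀ * V * A + Q - (Nᵀ + Bᵀ * V * A)ᵀ * (R + Bᵀ * V * B)⁻¹ * (Nᵀ + Bᵀ * V * A)).PosSemidef := by
  have hVs : Vᵀ = V := by
    have := hV.1
    rwa [IsHermitian, conjTranspose_eq_transpose_of_trivial] at this
  have hRs : Rᵀ = R := by
    have := hR.1
    rwa [IsHermitian, conjTranspose_eq_transpose_of_trivial] at this
  have hD := posDef_inputTerm (B := B) hV hR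
  have hDu : IsUnit (R + Bᵀ * V * B).det := hD.det_pos.ne'.isUnit
  refine PosSemidef.of_dotProduct_mulVec_nonneg ?_ fun x => ?_
  · rw [IsHermitian, conjTranspose_eq_transpose_of_trivial]
    have hDs : (R + Bᵀ * V * B)ᵀ = R + Bᵀ * V * B := by
      simp only [transpose_add, transpose_mul, transpose_transpose, hVs, hRs, Matrix.mul_assoc]
    rw [transpose_sub, transpose_mul, transpose_mul, transpose_nonsing_inv, hDs, transpose_transpose]
    simp only [transpose_add, transpose_mul, transpose_transpose, hVs, hQ, Matrix.mul_assoc]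
  -- At the minimizing input the completed square vanishes, so the new quadratic form is a value of
  -- the nonnegative stage cost plus cost-to-go.
  · have h := riccati_step (A := A) (B := B) (Q := Q) (N := N) hVs hRs hDu x
      (-((R + Bᵀ * V * B)⁻¹ *ᵥ (Nᵀ + Bᵀ * V * A) *ᵥ x))
    rw [neg_add_cancel, zero_dotProduct, add_zero] at h
    rw [star_trivial, ← h]
    refine add_nonneg (hQN _ _) ?_
    have := hV.dotProduct_mulVec_nonneg
      (A *ᵥ x + B *ᵥ -((R + Bᵀ * V * B)⁻¹ *ᵥ (Nᵀ + Bᵀ * V * A) *ᵥ x))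
    rwa [star_trivial] at this

end RiccatiStep

/-! ### Cost weights and cost-to-go matrices of the coordinated system -/

section Coordinated

variable {n dx k T : ℕ} {dy du : Fin n → ℕ} (sys : LQGSystem dx dy du)
  (G : ObsGain dy du) (H : MemGain dy du k)

/-- The cost of one step, in terms of the coordinated state. -/
theorem coordQ_cost (t : ℕ) (x : Fin dx → ℝ) (y : Stack dy → ℝ) (m : MemIdx dy du k → ℝ)
    (u : Stack du → ℝ) :
    (Sum.elim x (Sum.elim y m)) ⬝ᵥ coordQ sys G H t *ᵥ (Sum.elim x (Sum.elim y m)) +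
        2 * ((Sum.elim x (Sum.elim y m)) ⬝ᵥ coordN sys G H t *ᵥ u) + u ⬝ᵥ sys.R *ᵥ u =
      x ⬝ᵥ sys.Q *ᵥ x + (u + G.diag t *ᵥ y + H.diag t *ᵥ m) ⬝ᵥ sys.R *ᵥ
        (u + G.diag t *ᵥ y + H.diag t *ᵥ m) := by
  have hR : sys.Rᵀ = sys.R := by
    have := sys.R_pd.1
    rwa [IsHermitian, conjTranspose_eq_transpose_of_trivial] at this
  simp only [coordQ, coordN, fromBlocks_mulVec, fromRows_mulVec, Sum.elim_comp_inl,
    Sum.elim_comp_inr, zero_mulVec, add_zero, zero_add, sumElim_dotProduct_sumElim,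
    dotProduct_zero, dotProduct_add, add_dotProduct, mulVec_add, ← mulVec_mulVec,
    ← mulVec_dotProduct_eq]
  rw [dotProduct_mulVec_comm hR u (G.diag t *ᵥ y), dotProduct_mulVec_comm hR u (H.diag t *ᵥ m),
    dotProduct_mulVec_comm hR (G.diag t *ᵥ y) (H.diag t *ᵥ m)]
  ring

theorem sumElim_proj {α β γ δ : Type*} (v : α ⊕ (β ⊕ γ) → δ) :
    Sum.elim (fun i => v (Sum.inl i))
      (Sum.elim (fun i => v (Sum.inr (Sum.inl i))) (fun i => v (Sum.inr (Sum.inr i)))) = v := by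
  funext i
  rcases i with i | i | i <;> rfl

/-- The left side is the original stage cost with `U = u + G y + H m`, so the signs of `Q` and `R`
decide. This is what keeps the cost-to-go matrices positive semidefinite. -/
theorem coordQ_nonneg (t : ℕ) (x : CoordIdx dx dy du k → ℝ) (u : Stack du → ℝ) :
    0 ≤ x ⬝ᵥ coordQ sys G H t *ᵥ x + 2 * (x ⬝ᵥ coordN sys G H t *ᵥ u) + u ⬝ᵥ sys.R *ᵥ u := by
  rw [← sumElim_proj x, coordQ_cost]
  have h1 := sys.Q_psd.dotProduct_mulVec_nonneg fun i => x (Sum.inl i)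
  have h2 := sys.R_pd.posSemidef.dotProduct_mulVec_nonneg
    (u + (G.diag t *ᵥ fun i => x (Sum.inr (Sum.inl i))) +
      H.diag t *ᵥ fun i => x (Sum.inr (Sum.inr i)))
  rw [star_trivial] at h1 h2
  exact add_nonneg h1 h2

theorem coordQ_transpose (t : ℕ) : (coordQ sys G H t)ᵀ = coordQ sys G H t := by
  have hR : sys.Rᵀ = sys.R := by
    have := sys.R_pd.1
    rwa [IsHermitian, conjTranspose_eq_transpose_of_trivial] at this
  have hQ : sys.Qᵀ = sys.Q := by
    have := sys.Q_psd.1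
    rwa [IsHermitian, conjTranspose_eq_transpose_of_trivial] at this
  simp only [coordQ, fromBlocks_transpose, transpose_mul, transpose_transpose, hR, hQ,
    transpose_zero, Matrix.mul_assoc]

theorem costToGoRev_posSemidef (r : ℕ) : (costToGoRev sys G H T r).PosSemidef := by
  induction r with
  | zero => exact PosSemidef.zero
  | succ r ih =>
    exact posSemidef_riccati_step ih sys.R_pd (coordQ_transpose sys G H _)
      (coordQ_nonneg sys G H _)

theorem costToGo_posSemidef (t : ℕ) : (costToGo sys G H T t).PosSemidef :=
  costToGoRev_posSemidef sys G H _

theorem costToGo_last : costToGo sys G H T (T + 1) = 0 := by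
  simp [costToGo, costToGoRev]

/-- Serves twice: invertibility for the completion of squares, and strict convexity for the
uniqueness of the optimal actions. -/
theorem inputTerm_posDef (t s : ℕ) :
    (inputTerm sys t (costToGo sys G H T s)).PosDef :=
  posDef_inputTerm (costToGo_posSemidef sys G H s) sys.R_pd

theorem costToGo_eq {t : ℕ} (ht : t ≤ T) :
    costToGo sys G H T t = (coordA sys G H t)ᵀ * costToGo sys G H T (t + 1) * coordA sys G H t +
      coordQ sys G H t - (crossTerm sys G H t (costToGo sys G H T (t + 1)))ᵀ *
        (inputTerm sys t (costToGo sys G H T (t + 1)))⁻¹ *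
          crossTerm sys G H t (costToGo sys G H T (t + 1)) := by
  have h1 : T + 1 - t = (T - t) + 1 := by omega
  have h2 : T + 1 - (t + 1) = T - t := by omega
  have h3 : T - (T - t) = t := by omega
  simp only [costToGo, h1, h2]
  rw [costToGoRev, h3]

/-- The completion of squares for the coordinated system. -/
theorem coord_step {t : ℕ} (ht : t ≤ T) (x : CoordIdx dx dy du k → ℝ) (u : Stack du → ℝ) :
    x ⬝ᵥ coordQ sys G H t *ᵥ x + 2 * (x ⬝ᵥ coordN sys G H t *ᵥ u) + u ⬝ᵥ sys.R *ᵥ u +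
        (coordA sys G H t *ᵥ x + coordB sys k t *ᵥ u) ⬝ᵥ costToGo sys G H T (t + 1) *ᵥ
          (coordA sys G H t *ᵥ x + coordB sys k t *ᵥ u) =
      x ⬝ᵥ costToGo sys G H T t *ᵥ x +
        (u - coordGain sys G H T t *ᵥ x) ⬝ᵥ inputTerm sys t (costToGo sys G H T (t + 1)) *ᵥ
          (u - coordGain sys G H T t *ᵥ x) := by
  have hV : (costToGo sys G H T (t + 1))ᵀ = costToGo sys G H T (t + 1) := by
    have := (costToGo_posSemidef (T := T) sys G H (t + 1)).1
    rwa [IsHermitian, conjTranspose_eq_transpose_of_trivial] at this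
  have hR : sys.Rᵀ = sys.R := by
    have := sys.R_pd.1
    rwa [IsHermitian, conjTranspose_eq_transpose_of_trivial] at this
  have h := riccati_step (A := coordA sys G H t) (Q := coordQ sys G H t) (N := coordN sys G H t)
    hV hR (inputTerm_posDef (T := T) sys G H t (t + 1)).det_pos.ne'.isUnit x u
  rw [h, costToGo_eq sys G H ht, coordGain, neg_mulVec, sub_neg_eq_add, ← mulVec_mulVec]
  rfl

end Coordinated

/-! ### Dynamics of the memories and of the coordinated state -/

section Memory

variable {n dx k : ℕ} {dy du : Fin n → ℕ}

theorem blockDiagonal'_mulVec {m' n' : Fin n → Type*} [∀ i, Fintype (n' i)]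
    (D : ∀ i, Matrix (m' i) (n' i) ℝ) (v : (Σ i, n' i) → ℝ) (p : Σ i, m' i) :
    (blockDiagonal' D *ᵥ v) p = (D p.1 *ᵥ fun q => v ⟨p.1, q⟩) p.2 := by
  obtain ⟨i, a⟩ := p
  simp only [mulVec, dotProduct, Fintype.sum_sigma]
  rw [Finset.sum_eq_single i]
  · simp only [blockDiagonal'_apply_eq]
  · intro j _ hj
    simp only [blockDiagonal'_apply_ne _ _ _ (Ne.symm hj), zero_mul, Finset.sum_const_zero]
  · simp

/-- The update of the local memories. -/
theorem localMem_succ (h : ℕ → Signal dx dy du) {t : ℕ} (ht : 1 ≤ t) :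
    localMem k h (t + 1) = Pmm dy du k *ᵥ localMem k h t + Pmy dy du k *ᵥ (h t).y +
      Pmu dy du k *ᵥ (h t).u := by
  funext ⟨i, j, c⟩
  simp only [Pi.add_apply, Pmm, Pmy, Pmu, blockDiagonal'_mulVec]
  simp only [mulVec, dotProduct, of_apply]
  -- The newest block is filled by `Y_t` and `U_t` alone; any other block is copied from position `j
  -- - 1`, the only nonzero entry in its row of `Pmm`.
  by_cases hj : (j : ℕ) = 0
  · simp only [hj, true_and]
    rcases c with a | b <;> simp [localMem, hj]
  · have h1 : ∀ q : LocalIdx dy du k i, ((j : ℕ) = q.1 + 1 ∧ c = q.2) ↔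
        q = (⟨(j : ℕ) - 1, by omega⟩, c) := by
      rintro ⟨q, d⟩
      simp only [Prod.mk.injEq, Fin.ext_iff]
      constructor
      · rintro ⟨h, rfl⟩
        exact ⟨by omega, rfl⟩
      · rintro ⟨h, rfl⟩
        exact ⟨by omega, rfl⟩
    have h2 : t - (j : ℕ) = t - 1 - ((j : ℕ) - 1) := by omega
    simp only [h1, hj, false_and, if_false, zero_mul, Finset.sum_const_zero, add_zero, ite_mul,
      one_mul, Finset.sum_ite_eq', Finset.mem_univ, if_true]
    rcases c with a | b <;> simp [localMem, h2]

variable (sys : LQGSystem dx dy du) (σ : Strategy dy du k)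
  {Ω : Type*} (ξ : Ω → Noise dx dy)

theorem M_succ {t : ℕ} (ht : 1 ≤ t) : M sys σ ξ (t + 1) = fun ω =>
    Pmm dy du k *ᵥ M sys σ ξ t ω + Pmy dy du k *ᵥ Y sys σ ξ t ω + Pmu dy du k *ᵥ U sys σ ξ t ω :=
  funext fun ω => localMem_succ (traj sys σ (ξ ω)) ht

/-- The dynamics of the coordinated system. -/
theorem coordState_succ (hk : 1 ≤ k) {t : ℕ} (ht : 1 ≤ t) (ω : Ω) :
    coordState sys σ ξ (t + 1) ω = coordA sys σ.G σ.H t *ᵥ coordState sys σ ξ t ω +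
      coordB sys k t *ᵥ Ut sys σ ξ t ω +
      coordF sys k t *ᵥ Sum.elim ((ξ ω).w0 t) (fun p => (ξ ω).wi (t + 1) p.1 p.2) := by
  unfold coordState
  rw [Y_eq sys σ ξ hk (by omega : 1 ≤ t + 1), X_succ sys σ ξ hk ht, M_succ sys σ ξ ht,
    U_eq sys σ ξ hk ht]
  simp only [coordA, coordB, coordF, fromRows_mulVec, fromCols_mulVec, Sum.elim_comp_inl,
    Sum.elim_comp_inr, one_mulVec, zero_mulVec, add_zero, zero_add, add_mulVec, mulVec_add,
    ← mulVec_mulVec]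
  funext i
  rcases i with i | i | i <;>
  · simp only [Pi.add_apply, Sum.elim_inl, Sum.elim_inr, Pi.zero_apply]
    ring

end Memory

/-! ### Expected quadratic costs and their decomposition -/

namespace IsGaussianSpace

variable {Ω : Type*} {mΩ : MeasurableSpace Ω} {μ : Measure Ω} {E : Submodule ℝ (Ω → ℝ)}
  (hE : IsGaussianSpace μ E) {ι κ : Type*} [Fintype ι] [Fintype κ] {v : Ω → ι → ℝ} {w : Ω → κ → ℝ}

include hE

theorem integrable_dotProduct (A : Matrix ι κ ℝ) (hv : InSpan E v) (hw : InSpan E w) :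
    Integrable (fun ω => v ω ⬝ᵥ A *ᵥ w ω) μ := by
  simp only [dotProduct]
  exact integrable_finsetSum _ fun i _ => hE.integrable_mul (hv i) (hw.mulVec A i)

theorem integral_dotProduct (A : Matrix ι κ ℝ) (hv : InSpan E v) (hw : InSpan E w) :
    ∫ ω, v ω ⬝ᵥ A *ᵥ w ω ∂μ = trace (crossMoment μ v w * Aᵀ) := by
  simp only [dotProduct]
  rw [integral_finsetSum _ fun i _ => hE.integrable_mul (hv i) (hw.mulVec A i),
    ← hE.crossMoment_mulVec_right A hv hw]
  rfl

end IsGaussianSpace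

section Cost

variable {n dx k T : ℕ} {dy du : Fin n → ℕ} {sys : LQGSystem dx dy du}
  {Ω : Type*} {mΩ : MeasurableSpace Ω} {μ : Measure Ω} {ξ : Ω → Noise dx dy}
  (hξ : IsPrimitive sys T μ ξ) (σ : Strategy dy du k)

/-- The cost of one step. -/
noncomputable def stageCost (sys : LQGSystem dx dy du) (σ : Strategy dy du k) (ξ : Ω → Noise dx dy) (t : ℕ)
    (ω : Ω) : ℝ :=
  X sys σ ξ t ω ⬝ᵥ sys.Q *ᵥ X sys σ ξ t ω + U sys σ ξ t ω ⬝ᵥ sys.R *ᵥ U sys σ ξ t ω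

include hξ in
theorem integrable_stageCost (hk : 1 ≤ k) {t : ℕ} (ht : t ≤ T) :
    Integrable (stageCost sys σ ξ t) μ := by
  have hX : InSpan (primSpan ξ (Set.univ : Set (PrimIdx n T))) (X sys σ ξ t) :=
    (inSpan_past_X hk (by omega : t ≤ T + 1) le_rfl le_rfl).mono (primSpan_le_univ ξ _)
  have hU : InSpan (primSpan ξ (Set.univ : Set (PrimIdx n T))) (U sys σ ξ t) :=
    (inSpan_past_U hk ht le_rfl le_rfl).mono (primSpan_le_univ ξ _)
  exact (hξ.isGaussianSpace.integrable_dotProduct sys.Q hX hX).add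
    (hξ.isGaussianSpace.integrable_dotProduct sys.R hU hU)

theorem pathCost_eq : pathCost sys σ ξ T = fun ω => ∑ t ∈ Icc 1 T, stageCost sys σ ξ t ω := rfl

include hξ in
theorem integrable_pathCost (hk : 1 ≤ k) : Integrable (pathCost sys σ ξ T) μ := by
  rw [pathCost_eq]
  exact integrable_finsetSum _ fun t ht => integrable_stageCost hξ σ hk (mem_Icc.1 ht).2

include hξ in
theorem cost_eq_sum (hk : 1 ≤ k) :
    cost sys σ ξ μ T = ∑ t ∈ Icc 1 T, ∫ ω, stageCost sys σ ξ t ω ∂μ := by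
  rw [cost, pathCost_eq]
  exact integral_finsetSum _ fun t ht => integrable_stageCost hξ σ hk (mem_Icc.1 ht).2

theorem stageCost_eq (hk : 1 ≤ k) {t : ℕ} (ht : 1 ≤ t) (ω : Ω) : stageCost sys σ ξ t ω =
    coordState sys σ ξ t ω ⬝ᵥ coordQ sys σ.G σ.H t *ᵥ coordState sys σ ξ t ω +
      2 * (coordState sys σ ξ t ω ⬝ᵥ coordN sys σ.G σ.H t *ᵥ Ut sys σ ξ t ω) +
      Ut sys σ ξ t ω ⬝ᵥ sys.R *ᵥ Ut sys σ ξ t ω := by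
  rw [coordState, coordQ_cost, stageCost, U_eq sys σ ξ hk ht]

variable {xh xh' ee ee' : Ω → CoordIdx dx dy du k → ℝ} {t : ℕ}

/-- The weighted square of the deviation of an action `u` from the optimal action `g`. -/
noncomputable def deviation (sys : LQGSystem dx dy du) (G : ObsGain dy du) (H : MemGain dy du k) (T t : ℕ)
    (u g : Stack du → ℝ) : ℝ :=
  (u - g) ⬝ᵥ inputTerm sys t (costToGo sys G H T (t + 1)) *ᵥ (u - g)

/-- The expected cost of one step, for the estimate `xh` of the coordinated state and the error
`ee`. -/
theorem integral_stageCost (hk : 1 ≤ k) (ht1 : 1 ≤ t) (ht : t ≤ T)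
    (hx : InSpan (obsSpan sys σ ξ (t - k)) xh)
    (hee : InSpan (hξ.isGaussianSpace.orth (obsSpan sys σ ξ (t - k))) ee)
    (hs : ∀ ω, coordState sys σ ξ t ω = xh ω + ee ω) :
    ∫ ω, stageCost sys σ ξ t ω ∂μ + trace (crossMoment μ
        (fun ω => coordA sys σ.G σ.H t *ᵥ xh ω + coordB sys k t *ᵥ Ut sys σ ξ t ω)
        (fun ω => coordA sys σ.G σ.H t *ᵥ xh ω + coordB sys k t *ᵥ Ut sys σ ξ t ω) *
          costToGo sys σ.G σ.H T (t + 1)) =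
      trace (crossMoment μ ee ee * coordQ sys σ.G σ.H t) +
      trace (crossMoment μ xh xh * costToGo sys σ.G σ.H T t) +
      ∫ ω, deviation sys σ.G σ.H T t (Ut sys σ ξ t ω) (coordGain sys σ.G σ.H T t *ᵥ xh ω) ∂μ := by
  have hG := hξ.isGaussianSpace
  have hle := obsSpan_le_univ (T := T) sys σ ξ hk (r := t - k) (by omega)
  have hxE := hx.mono hle
  have heE := hee.mono hG.orth_le
  have hu := Ut_mem_obsSpan sys σ ξ hk (le_refl (t - k))
  have huE := hu.mono hle
  have hzE := (hxE.mulVec (coordA sys σ.G σ.H t)).add (huE.mulVec (coordB sys k t))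
  have hdE := huE.sub (hxE.mulVec (coordGain sys σ.G σ.H T t))
  have hex : crossMoment μ ee xh = 0 := hG.crossMoment_orth hee hx hle
  have hxe : crossMoment μ xh ee = 0 := by
    rw [← IsGaussianSpace.crossMoment_transpose, hex, transpose_zero]
  have heu : crossMoment μ ee (Ut sys σ ξ t) = 0 := hG.crossMoment_orth hee hu hle
  have hV (s : ℕ) : (costToGo sys σ.G σ.H T s)ᵀ = costToGo sys σ.G σ.H T s := by
    have := (costToGo_posSemidef (T := T) sys σ.G σ.H s).1
    rwa [IsHermitian, conjTranspose_eq_transpose_of_trivial] at this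
  -- The square is completed at the estimate `xh`, not at the state. The error adds its own
  -- quadratic term and terms bilinear in `ee` and `xh` or `Ũ_t`, whose expectations vanish by
  -- orthogonality.
  have key : ∀ ω, stageCost sys σ ξ t ω +
      (coordA sys σ.G σ.H t *ᵥ xh ω + coordB sys k t *ᵥ Ut sys σ ξ t ω) ⬝ᵥ
        costToGo sys σ.G σ.H T (t + 1) *ᵥ
          (coordA sys σ.G σ.H t *ᵥ xh ω + coordB sys k t *ᵥ Ut sys σ ξ t ω) =
      xh ω ⬝ᵥ costToGo sys σ.G σ.H T t *ᵥ xh ω +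
      deviation sys σ.G σ.H T t (Ut sys σ ξ t ω) (coordGain sys σ.G σ.H T t *ᵥ xh ω) +
      (ee ω ⬝ᵥ coordQ sys σ.G σ.H t *ᵥ ee ω + (ee ω ⬝ᵥ coordQ sys σ.G σ.H t *ᵥ xh ω +
        xh ω ⬝ᵥ coordQ sys σ.G σ.H t *ᵥ ee ω + 2 * (ee ω ⬝ᵥ coordN sys σ.G σ.H t *ᵥ
          Ut sys σ ξ t ω))) := by
    intro ω
    rw [deviation, ← coord_step sys σ.G σ.H ht, stageCost_eq σ hk ht1, hs]
    simp only [mulVec_add, add_dotProduct, dotProduct_add]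
    ring
  have i1 := hG.integrable_dotProduct (costToGo sys σ.G σ.H T (t + 1)) hzE hzE
  have i2 := hG.integrable_dotProduct (costToGo sys σ.G σ.H T t) hxE hxE
  have i3 : Integrable (fun ω => deviation sys σ.G σ.H T t (Ut sys σ ξ t ω)
      (coordGain sys σ.G σ.H T t *ᵥ xh ω)) μ := hG.integrable_dotProduct _ hdE hdE
  have i4 := hG.integrable_dotProduct (coordQ sys σ.G σ.H t) heE heE
  have i5 := hG.integrable_dotProduct (coordQ sys σ.G σ.H t) heE hxE
  have i6 := hG.integrable_dotProduct (coordQ sys σ.G σ.H t) hxE heE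
  have i7 := hG.integrable_dotProduct (coordN sys σ.G σ.H t) heE huE
  have h := integral_congr_ae (μ := μ) (Filter.Eventually.of_forall key)
  rw [integral_add (integrable_stageCost hξ σ hk ht) i1, integral_add (i2.fun_add i3)
    (i4.fun_add ((i5.fun_add i6).fun_add (i7.const_mul 2))), integral_add i2 i3,
    integral_add i4 ((i5.fun_add i6).fun_add (i7.const_mul 2)), integral_add (i5.fun_add i6) (i7.const_mul 2),
    integral_add i5 i6, integral_const_mul, hG.integral_dotProduct _ hzE hzE,
    hG.integral_dotProduct _ hxE hxE, hG.integral_dotProduct _ heE heE,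
    hG.integral_dotProduct _ heE hxE, hG.integral_dotProduct _ hxE heE,
    hG.integral_dotProduct _ heE huE, hex, hxe, heu, hV, hV, coordQ_transpose] at h
  simp only [Matrix.zero_mul, trace_zero, add_zero, mul_zero] at h
  rw [h]
  ring

/-- The second moment of the next estimate of the coordinated state. -/
theorem crossMoment_estimate_succ (hk : 1 ≤ k) (ht1 : 1 ≤ t) (ht : t + 1 ≤ T)
    (hx : InSpan (obsSpan sys σ ξ (t - k)) xh)
    (hee : InSpan (hξ.isGaussianSpace.orth (obsSpan sys σ ξ (t - k))) ee)
    (hs : ∀ ω, coordState sys σ ξ t ω = xh ω + ee ω)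
    (hx' : InSpan (obsSpan sys σ ξ (t + 1 - k)) xh')
    (hee' : InSpan (hξ.isGaussianSpace.orth (obsSpan sys σ ξ (t + 1 - k))) ee')
    (hs' : ∀ ω, coordState sys σ ξ (t + 1) ω = xh' ω + ee' ω) :
    crossMoment μ xh' xh' = crossMoment μ
        (fun ω => coordA sys σ.G σ.H t *ᵥ xh ω + coordB sys k t *ᵥ Ut sys σ ξ t ω)
        (fun ω => coordA sys σ.G σ.H t *ᵥ xh ω + coordB sys k t *ᵥ Ut sys σ ξ t ω) +
      (coordCovW sys k t + coordA sys σ.G σ.H t * crossMoment μ ee ee * (coordA sys σ.G σ.H t)ᵀ -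
        crossMoment μ ee' ee') := by
  have hG := hξ.isGaussianSpace
  have hle := obsSpan_le_univ (T := T) sys σ ξ hk (r := t - k) (by omega)
  have hle' := obsSpan_le_univ (T := T) sys σ ξ hk (r := t + 1 - k) (by omega)
  have hxE := hx.mono hle
  have heE := hee.mono hG.orth_le
  have hxE' := hx'.mono hle'
  have heE' := hee'.mono hG.orth_le
  have hu := Ut_mem_obsSpan sys σ ξ hk (le_refl (t - k))
  have huE := hu.mono hle
  -- the decomposition of the next state
  set z : Ω → CoordIdx dx dy du k → ℝ := fun ω =>
    coordA sys σ.G σ.H t *ᵥ xh ω + coordB sys k t *ᵥ Ut sys σ ξ t ω with hz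
  set W : Ω → Fin dx ⊕ Stack dy → ℝ := fun ω =>
    Sum.elim ((ξ ω).w0 t) (fun p => (ξ ω).wi (t + 1) p.1 p.2) with hW
  set d : Ω → CoordIdx dx dy du k → ℝ := fun ω =>
    coordA sys σ.G σ.H t *ᵥ ee ω + coordF sys k t *ᵥ W ω with hd
  have hzS : InSpan (obsSpan sys σ ξ (t - k)) z := (hx.mulVec _).add (hu.mulVec _)
  have hzE := hzS.mono hle
  have hWo : InSpan (hG.orth (primSpan ξ (past n T t (t + 1)))) W :=
    (hξ.w0_mem_orth ht1 (by omega) le_rfl).elim (hξ.wi_mem_orth (by omega) ht le_rfl)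
  have hWE := hWo.mono hG.orth_le
  have hWobs := hWo.mono (hG.orth_anti
    (obsSpan_le_past sys σ ξ hk (T := T) (r := t - k) (by omega) (by omega) (by omega)))
  have hdo : InSpan (hG.orth (obsSpan sys σ ξ (t - k))) d := (hee.mulVec _).add (hWobs.mulVec _)
  have hdE := hdo.mono hG.orth_le
  -- The error at time `t` contains sensor noise up to `t` and plant noise before `t`, hence is
  -- uncorrelated with `W`.
  have heP : InSpan (primSpan ξ (past n T t (t + 1))) ee := by
    convert (inSpan_past_coordState (sys := sys) (σ := σ) (ξ := ξ) hk (by omega : t ≤ T) le_rfl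
      le_rfl).sub (hx.mono
      (obsSpan_le_past sys σ ξ hk (T := T) (by omega) (by omega) (by omega))) using 2
    rw [hs]
    exact (add_sub_cancel_left _ _).symm
  have hWe : crossMoment μ W ee = 0 := hG.crossMoment_orth hWo heP (primSpan_le_univ ξ _)
  have heW : crossMoment μ ee W = 0 := by
    rw [← IsGaussianSpace.crossMoment_transpose, hWe, transpose_zero]
  have hWW : crossMoment μ W W = Matrix.fromBlocks sys.covW0 0 0 sys.covW := by
    have m := hξ.crossMoment_w0_wi ht1 (by omega) (by omega : 1 ≤ t + 1) ht
    have m' := congrArg Matrix.transpose m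
    rw [IsGaussianSpace.crossMoment_transpose, transpose_zero] at m'
    ext i j
    rcases i with i | i <;> rcases j with j | j
    · exact congrFun (congrFun (hξ.crossMoment_w0 ht1 (by omega)) i) j
    · exact congrFun (congrFun m i) j
    · exact congrFun (congrFun m' i) j
    · exact congrFun (congrFun (hξ.crossMoment_wi (by omega) ht) i) j
  have hdd : crossMoment μ d d = coordCovW sys k t +
      coordA sys σ.G σ.H t * crossMoment μ ee ee * (coordA sys σ.G σ.H t)ᵀ := by
    have h1 : crossMoment μ d d = crossMoment μ d
      (fun ω => coordA sys σ.G σ.H t *ᵥ ee ω + coordF sys k t *ᵥ W ω) := rfl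
    rw [h1, hG.crossMoment_add_right hdE (heE.mulVec _) (hWE.mulVec _),
      hG.crossMoment_mulVec_right _ hdE heE, hG.crossMoment_mulVec_right _ hdE hWE, hd,
      hG.crossMoment_add_left (heE.mulVec _) (hWE.mulVec _) heE,
      hG.crossMoment_add_left (heE.mulVec _) (hWE.mulVec _) hWE,
      hG.crossMoment_mulVec_left _ heE heE, hG.crossMoment_mulVec_left _ heE hWE,
      hG.crossMoment_mulVec_left _ hWE heE, hG.crossMoment_mulVec_left _ hWE hWE, hWe, heW, hWW,
      Matrix.mul_zero, Matrix.mul_zero, add_zero, zero_add, coordCovW, add_comm]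
  have hsum : (fun ω => xh' ω + ee' ω) = fun ω => z ω + d ω := by
    funext ω
    rw [← hs', coordState_succ sys σ ξ hk ht1, hs]
    simp only [hz, hd, mulVec_add]
    abel
  -- Pythagoras, applied to both orthogonal splittings `xh' + ee' = z + d` of the next state. The
  -- update rule for the estimate is thereby never needed.
  have hsq : ∀ {p q : Ω → CoordIdx dx dy du k → ℝ},
      InSpan (primSpan ξ (Set.univ : Set (PrimIdx n T))) p →
      InSpan (primSpan ξ (Set.univ : Set (PrimIdx n T))) q → crossMoment μ q p = 0 →
      crossMoment μ (fun ω => p ω + q ω) (fun ω => p ω + q ω) =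
        crossMoment μ p p + crossMoment μ q q := by
    intro p q hp hq h0
    have h0' : crossMoment μ p q = 0 := by
      rw [← IsGaussianSpace.crossMoment_transpose, h0, transpose_zero]
    rw [hG.crossMoment_add_left hp hq (hp.add hq), hG.crossMoment_add_right hp hp hq,
      hG.crossMoment_add_right hq hp hq, h0, h0', add_zero, zero_add]
  have e1 := hsq hxE' heE' (hG.crossMoment_orth hee' hx' hle')
  have e2 := hsq hzE hdE (hG.crossMoment_orth hdo hzS hle)
  rw [hsum, e2, hdd] at e1
  rw [eq_sub_of_add_eq e1.symm]
  abel

/-- The cost of a strategy exceeds the optimal cost by the expected deviations of the actions from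
the optimal ones. -/
theorem cost_eq_optCost_add (hk : 1 ≤ k) (σ : Strategy dy du k)
    {xh ee : ℕ → Ω → CoordIdx dx dy du k → ℝ}
    (hx : ∀ t ∈ Icc 1 T, InSpan (obsSpan sys σ ξ (t - k)) (xh t))
    (hee : ∀ t ∈ Icc 1 T, InSpan (hξ.isGaussianSpace.orth (obsSpan sys σ ξ (t - k))) (ee t))
    (hs : ∀ t ∈ Icc 1 T, ∀ ω, coordState sys σ ξ t ω = xh t ω + ee t ω) :
    cost sys σ ξ μ T = optCost sys σ.G σ.H T (fun t => crossMoment μ (ee t) (ee t)) +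
      ∑ t ∈ Icc 1 T, ∫ ω, deviation sys σ.G σ.H T t (Ut sys σ ξ t ω)
        (coordGain sys σ.G σ.H T t *ᵥ xh t ω) ∂μ := by
  set f : ℕ → ℝ := fun t => trace (crossMoment μ (xh t) (xh t) * costToGo sys σ.G σ.H T t) with hf
  have hstep : ∀ t ∈ Icc 1 T, ∫ ω, stageCost sys σ ξ t ω ∂μ =
      (trace (crossMoment μ (ee t) (ee t) * coordQ sys σ.G σ.H t +
        (coordCovW sys k t + coordA sys σ.G σ.H t * crossMoment μ (ee t) (ee t) *
          (coordA sys σ.G σ.H t)ᵀ - crossMoment μ (ee (t + 1)) (ee (t + 1))) *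
          costToGo sys σ.G σ.H T (t + 1)) +
      ∫ ω, deviation sys σ.G σ.H T t (Ut sys σ ξ t ω)
        (coordGain sys σ.G σ.H T t *ᵥ xh t ω) ∂μ) - (f (t + 1) - f t) := by
    intro t ht
    obtain ⟨ht1, htT⟩ := mem_Icc.1 ht
    have h1 := integral_stageCost hξ σ hk ht1 htT (hx t ht) (hee t ht) (hs t ht)
    -- At `t = T` no estimate for the next time is available, but it is only met multiplied by the
    -- zero matrix `V_{T+1}`.
    rcases Nat.lt_or_ge t T with hlt | hge
    · have ht' : t + 1 ∈ Icc 1 T := mem_Icc.2 ⟨by omega, hlt⟩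
      have h2 := crossMoment_estimate_succ hξ σ hk ht1 hlt (hx t ht) (hee t ht) (hs t ht)
        (hx _ ht') (hee _ ht') (hs _ ht')
      have h3 : f (t + 1) = _ := congrArg (fun P => trace (P * costToGo sys σ.G σ.H T (t + 1))) h2
      rw [Matrix.add_mul, trace_add] at h3
      rw [h3, trace_add]
      simp only [hf]
      linarith
    · obtain rfl : t = T := by omega
      simp only [hf, costToGo_last, Matrix.mul_zero, trace_zero, add_zero] at h1 ⊢
      rw [h1]
      ring
  have htel : ∀ m : ℕ, ∑ t ∈ Icc 1 m, (f (t + 1) - f t) = f (m + 1) - f 1 := by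
    intro m
    induction m with
    | zero => simp
    | succ m ih =>
      rw [Finset.sum_Icc_succ_top (by omega), ih]
      ring
  have hlast : f (T + 1) = 0 := by
    simp only [hf, costToGo_last, Matrix.mul_zero, trace_zero]
  -- At time `1` nothing is shared, so the estimate lies in a zero space. For `T = 0` the hypotheses
  -- say nothing about `xh 1`; then `f 1` is already the final term.
  have hfirst : T = 0 ∨ f 1 = 0 := by
    rcases Nat.eq_zero_or_pos T with h | h
    · exact Or.inl h
    · right
      have h0 := hx 1 (mem_Icc.2 ⟨le_rfl, h⟩)
      have h1 : xh 1 = fun _ => 0 := by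
        funext ω i
        have h2 := h0 i
        rw [show 1 - k = 0 by omega] at h2
        have h3 : obsSpan sys σ ξ 0 = ⊥ := by simp [obsSpan]
        rw [h3, Submodule.mem_bot] at h2
        exact congrFun h2 ω
      have h2 : crossMoment μ (xh 1) (xh 1) = 0 := by
        ext i j
        simp [crossMoment, h1]
      simp only [hf, h2, Matrix.zero_mul, trace_zero]
  rw [cost_eq_sum hξ σ hk, Finset.sum_congr rfl hstep, Finset.sum_sub_distrib,
    Finset.sum_add_distrib, htel, hlast]
  rcases hfirst with rfl | h
  · have : f 1 = f (0 + 1) := rfl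
    rw [this, hlast, optCost]
    ring
  · rw [h, optCost]
    ring

end Cost

/-! ### Realizing the optimal actions by gains on the shared memory -/

section Realization

variable {n dx k T : ℕ} {dy du : Fin n → ℕ} {sys : LQGSystem dx dy du}
  {Ω : Type*} {ξ : Ω → Noise dx dy}
  {G : ObsGain dy du} {H : MemGain dy du k} {𝒦 : Set (SharedGain dy du k)} {t : ℕ}

/-- The random variables, indexed by the gains `K ∈ 𝒦` on the shared memory, that are a fixed linear
function of the shared memory at time `t`. -/
def sharedSpan (sys : LQGSystem dx dy du) (ξ : Ω → Noise dx dy) (G : ObsGain dy du)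
    (H : MemGain dy du k) (𝒦 : Set (SharedGain dy du k)) (t : ℕ) :
    Submodule ℝ (SharedGain dy du k × Ω → ℝ) where
  carrier := {φ | ∃ c : SharedIdx dy du k t → ℝ, ∀ K ∈ 𝒦, ∀ ω,
    φ (K, ω) = c ⬝ᵥ sharedMem k (traj sys ⟨K, G, H⟩ (ξ ω)) t}
  add_mem' := by
    rintro φ ψ ⟨c, h⟩ ⟨d, h'⟩
    refine ⟨c + d, fun K hK ω => ?_⟩
    rw [Pi.add_apply, h K hK, h' K hK, add_dotProduct]
  zero_mem' := ⟨0, fun K _ ω => by simp⟩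
  smul_mem' := by
    rintro r φ ⟨c, h⟩
    refine ⟨r • c, fun K hK ω => ?_⟩
    rw [Pi.smul_apply, h K hK, smul_dotProduct]

theorem sharedSpan_congr {ι : Type*} {v w : SharedGain dy du k × Ω → ι → ℝ}
    (hv : InSpan (sharedSpan sys ξ G H 𝒦 t) v) (h : ∀ K ∈ 𝒦, ∀ ω, w (K, ω) = v (K, ω)) :
    InSpan (sharedSpan sys ξ G H 𝒦 t) w := by
  intro i
  obtain ⟨c, hc⟩ := hv i
  exact ⟨c, fun K hK ω => (congrFun (h K hK ω) i).trans (hc K hK ω)⟩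

theorem Y_mem_sharedSpan {s : ℕ} (hs : s ≤ t - k) :
    InSpan (sharedSpan sys ξ G H 𝒦 t) (fun p => Y sys ⟨p.1, G, H⟩ ξ s p.2) := by
  rcases Nat.eq_zero_or_pos s with rfl | h
  · exact InSpan.zero
  · refine fun a => ⟨Pi.single (⟨s - 1, by omega⟩, Sum.inl a) 1, fun K _ ω => ?_⟩
    rw [single_dotProduct, one_mul]
    simp only [sharedMem, Sum.elim_inl, Nat.sub_add_cancel h, Y]

theorem U_mem_sharedSpan {s : ℕ} (hs : s ≤ t - k) :
    InSpan (sharedSpan sys ξ G H 𝒦 t) (fun p => U sys ⟨p.1, G, H⟩ ξ s p.2) := by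
  rcases Nat.eq_zero_or_pos s with rfl | h
  · exact InSpan.zero
  · refine fun a => ⟨Pi.single (⟨s - 1, by omega⟩, Sum.inr a) 1, fun K _ ω => ?_⟩
    rw [single_dotProduct, one_mul]
    simp only [sharedMem, Sum.elim_inr, Nat.sub_add_cancel h, U]

/-- Composition with `Prod.snd` regards a random variable of a fixed strategy as constant in the
gains, which carries linear relations over to the product. -/
theorem obsSpan_le_comap_snd {σ : Strategy dy du k} {r : ℕ}
    {S : Submodule ℝ (SharedGain dy du k × Ω → ℝ)}
    (h : ∀ s ≤ r, InSpan S (fun p => Y sys σ ξ s p.2)) :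
    obsSpan sys σ ξ r ≤ S.comap (LinearMap.funLeft ℝ ℝ Prod.snd) := by
  refine Submodule.span_le.2 ?_
  rintro _ ⟨s, hs, a, rfl⟩
  exact h s (mem_Icc.1 hs).2 a

/-- The effect of the controls on the state and the observations of a reference strategy are
functions of the shared memory. -/
theorem sub_mem_sharedSpan (hk : 1 ≤ k) (σ : Strategy dy du k) (s : ℕ) :
    (s ≤ t - k + 1 → InSpan (sharedSpan sys ξ G H 𝒦 t)
      (fun p => X sys ⟨p.1, G, H⟩ ξ s p.2 - X sys σ ξ s p.2)) ∧
    (s ≤ t - k → InSpan (sharedSpan sys ξ G H 𝒦 t) (fun p => Y sys σ ξ s p.2)) := by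
  induction s using Nat.strong_induction_on with
  | _ s ih =>
  rcases Nat.eq_zero_or_pos s with rfl | hs
  · exact ⟨fun _ => InSpan.zero.sub InSpan.zero, fun _ => InSpan.zero⟩
  have hX : s ≤ t - k + 1 → InSpan (sharedSpan sys ξ G H 𝒦 t)
      (fun p => X sys ⟨p.1, G, H⟩ ξ s p.2 - X sys σ ξ s p.2) := by
    intro hst
    obtain ⟨s, rfl⟩ := Nat.exists_eq_add_of_le' hs
    rcases Nat.eq_zero_or_pos s with rfl | hs'
    · refine sharedSpan_congr InSpan.zero fun K _ ω => ?_
      simp only [zero_add, X_one _ _ _ hk, sub_self]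
    -- The reference control is a linear function of the reference observations, which are in the
    -- span by induction.
    have hU : InSpan (sharedSpan sys ξ G H 𝒦 t) (fun p => U sys σ ξ s p.2) := fun b =>
      obsSpan_le_comap_snd (fun r hr => (ih r (by omega)).2 (by omega))
        (U_mem_obsSpan sys σ ξ hk (le_refl s) b)
    refine sharedSpan_congr ((((ih s (by omega)).1 (by omega)).mulVec (sys.A s)).add
      (((U_mem_sharedSpan (by omega : s ≤ t - k)).sub hU).mulVec (sys.B s))) fun K _ ω => ?_
    rw [X_succ sys _ ξ hk hs', X_succ sys σ ξ hk hs']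
    simp only [mulVec_sub]
    abel
  refine ⟨hX, fun hst => ?_⟩
  refine sharedSpan_congr ((Y_mem_sharedSpan hst).sub ((hX (by omega)).mulVec (sys.C s)))
    fun K _ ω => ?_
  rw [Y_eq sys σ ξ hk hs, Y_eq sys ⟨K, G, H⟩ ξ hk hs]
  simp only [mulVec_sub]
  abel

variable {mΩ : MeasurableSpace Ω} {μ : Measure Ω} {hξ : IsPrimitive sys T μ ξ}
  {e : ℕ → Ω → Fin dx → ℝ}

/-- The coefficients must be common to all gains that agree before `t`, since `K_t` is still to be
chosen from them. The predictor part is `X - e` of the reference strategy plus the effect of the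
controls; the past actions are the fixed gains `K₀ s` applied to older shared memories. -/
theorem linStat_mem_sharedSpan (hk : 1 ≤ k) {σ : Strategy dy du k} (he : ArePredErrors hξ σ e)
    (ht1 : 1 ≤ t) (ht : t ≤ T) (K₀ : SharedGain dy du k) :
    InSpan (sharedSpan sys ξ G H {K | ∀ s < t, K s = K₀ s} t)
      (fun p => linStat sys ⟨p.1, G, H⟩ ξ e t p.2) := by
  set 𝒦 : Set (SharedGain dy du k) := {K | ∀ s < t, K s = K₀ s} with h𝒦
  rintro (i | ⟨j, b⟩ | ⟨j, a | b⟩)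
  · have h1 := (he (t + 1 - k) (by omega)).sub
    have h2 : InSpan (sharedSpan sys ξ G H 𝒦 t)
        (fun p => X sys σ ξ (t + 1 - k) p.2 - e (t + 1 - k) p.2) := fun i =>
      obsSpan_le_comap_snd (fun r hr => (sub_mem_sharedSpan hk σ r).2 (by omega)) (h1 i)
    have h3 := (sub_mem_sharedSpan (sys := sys) (ξ := ξ) (G := G) (H := H) (𝒦 := 𝒦) (t := t) hk σ
      (t + 1 - k)).1 (by omega)
    have h4 : InSpan (sharedSpan sys ξ G H 𝒦 t)
        (fun p i => linStat sys ⟨p.1, G, H⟩ ξ e t p.2 (Sum.inl i)) := by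
      refine sharedSpan_congr (h3.add h2) fun K _ ω => ?_
      funext i
      simp only [linStat, Sum.elim_inl, Pi.add_apply, Pi.sub_apply]
      ring
    exact h4 i
  · set s := t - 1 - (j : ℕ) with hs
    have h : InSpan (sharedSpan sys ξ G H 𝒦 t) (fun p => Ut sys ⟨p.1, G, H⟩ ξ s p.2) := by
      rcases Nat.eq_zero_or_pos s with h0 | h0
      · rw [h0]
        exact InSpan.zero
      have h1 : InSpan (sharedSpan sys ξ G H 𝒦 t)
          (fun p => sharedMem k (traj sys ⟨p.1, G, H⟩ (ξ p.2)) s) := by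
        rintro ⟨r, a | b⟩
        · exact Y_mem_sharedSpan (by omega : (r : ℕ) + 1 ≤ t - k) a
        · exact U_mem_sharedSpan (by omega : (r : ℕ) + 1 ≤ t - k) b
      refine sharedSpan_congr (h1.mulVec (K₀ s)) fun K hK ω => ?_
      rw [Ut_eq sys _ ξ hk h0]
      simp only [hK s (by omega)]
    exact h b
  · exact Y_mem_sharedSpan (by omega : t - k - (j : ℕ) ≤ t - k) a
  · exact U_mem_sharedSpan (by omega : t - k - (j : ℕ) ≤ t - k) b

/-- Some gains on the shared memory realize given gains on the statistic `S_t`. -/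
theorem exists_sharedGain (hk : 1 ≤ k) {σ : Strategy dy du k} (he : ArePredErrors hξ σ e)
    (L : ℕ → Matrix (Stack du) (StatIdx dx dy du k) ℝ) :
    ∃ K : SharedGain dy du k, ∀ t ∈ Icc 1 T, ∀ ω,
      Ut sys ⟨K, G, H⟩ ξ t ω = L t *ᵥ linStat sys ⟨K, G, H⟩ ξ e t ω := by
  have h : ∀ (t : ℕ) (K₀ : SharedGain dy du k),
      ∃ κ : Matrix (Stack du) (SharedIdx dy du k t) ℝ, t ∈ Icc 1 T →
        ∀ K : SharedGain dy du k, (∀ s < t, K s = K₀ s) → ∀ ω,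
          L t *ᵥ linStat sys ⟨K, G, H⟩ ξ e t ω =
            κ *ᵥ sharedMem k (traj sys ⟨K, G, H⟩ (ξ ω)) t := by
    intro t K₀
    by_cases ht : t ∈ Icc 1 T
    · obtain ⟨ht1, htT⟩ := mem_Icc.1 ht
      choose κ hκ using (linStat_mem_sharedSpan (G := G) (H := H) hk he ht1 htT K₀).mulVec (L t)
      exact ⟨Matrix.of κ, fun _ K hK ω => funext fun i => hκ i K hK ω⟩
    · exact ⟨0, fun h => absurd h ht⟩
  choose F hF using h
  -- `Kseq t` has its entries before `t` in final form. `F t` sees only those, so setting entry `t`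
  -- is not circular, and the wanted gain is the diagonal `Kseq (t + 1) t`.
  let Kseq : ℕ → SharedGain dy du k := fun t =>
    Nat.rec (fun _ => 0) (fun t K => Function.update K t (F t K)) t
  have hsucc : ∀ t, Kseq (t + 1) = Function.update (Kseq t) t (F t (Kseq t)) := fun _ => rfl
  have hstab : ∀ s t, s < t → Kseq t s = Kseq (s + 1) s := by
    intro s t hst
    induction t, hst using Nat.le_induction with
    | base => rfl
    | succ t ht ih => rw [hsucc, Function.update_of_ne (by omega), ih]
  refine ⟨fun t => Kseq (t + 1) t, fun t ht ω => ?_⟩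
  rw [hF t (Kseq t) ht _ (fun s hs => (hstab s t hs).symm) ω,
    Ut_eq sys _ ξ hk (mem_Icc.1 ht).1]
  simp only [hsucc, Function.update_self]

end Realization

end DelayedSharing

/-! ### The estimation, sufficiency and optimality statements together -/

theorem corollary1 {n dx T k : ℕ} {dy du : Fin n → ℕ} (hk : 1 ≤ k) (sys : LQGSystem dx dy du)
    {Ω : Type*} [MeasurableSpace Ω] (μ : Measure Ω) [IsProbabilityMeasure μ]
    (ξ : Ω → Noise dx dy) (hξ : IsPrimitive sys T μ ξ) :
    -- The predictor obeys the Kalman recursion, with the same coefficients and the same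
    -- precomputed error covariance under every linear strategy.
    (∀ σ : Strategy dy du k,
      pred sys σ ξ μ 1 =ᵐ[μ] 0 ∧
      ((∀ t ∈ Finset.Icc 1 T, IsUnit (innovCov sys t).det) →
        (∀ t ∈ Finset.Icc 1 T, pred sys σ ξ μ (t + 1) =ᵐ[μ] fun ω =>
          sys.A t *ᵥ pred sys σ ξ μ t ω + sys.B t *ᵥ U sys σ ξ t ω +
            kalmanGain sys t (riccati sys t) *ᵥ (Y sys σ ξ t ω - sys.C t *ᵥ pred sys σ ξ μ t ω)) ∧
        (∀ t ∈ Finset.Icc 1 (T + 1),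
          condSecondMoment μ (info sys σ ξ (t - 1))
            (fun ω => X sys σ ξ t ω - pred sys σ ξ μ t ω) =ᵐ[μ] fun _ => riccati sys t))) ∧
    -- For fixed local gains, `S_t` is a sufficient statistic for the coordinator.
    (∀ (G : ObsGain dy du) (H : MemGain dy du k),
      ∃ (Λ : ℕ → Matrix (EstIdx dx dy du k) (StatIdx dx dy du k) ℝ)
        (Pi : ℕ → Matrix (CoordIdx dx dy du k) (CoordIdx dx dy du k) ℝ)
        (L : ℕ → Matrix (Stack du) (StatIdx dx dy du k) ℝ),
        -- the estimate of `vec(X_t, M_t)` is a fixed linear function of `S_t`, and the error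
        -- covariance of the estimate of `vec(X_t, Y_t, M_t)` is fixed
        (∀ K : SharedGain dy du k, ∀ t ∈ Finset.Icc 1 T,
          stateMemEst sys ⟨K, G, H⟩ ξ μ t =ᵐ[μ] (fun ω => Λ t *ᵥ stat sys ⟨K, G, H⟩ ξ μ t ω) ∧
          condSecondMoment μ (coordInfo sys ⟨K, G, H⟩ ξ t)
            (fun ω => coordState sys ⟨K, G, H⟩ ξ t ω - coordEst sys ⟨K, G, H⟩ ξ μ t ω)
              =ᵐ[μ] fun _ => Pi t) ∧
        -- the gain on `S_t` is the optimal gain of the coordinated system on this estimate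
        (∀ t ∈ Finset.Icc 1 T, L t = coordGain sys G H T t * embed sys k t * Λ t) ∧
        (∀ K : SharedGain dy du k, Integrable (pathCost sys ⟨K, G, H⟩ ξ T) μ) ∧
        -- some strategy of the form `U_t = L_t S_t + G_t Y_t + H_t M_t` is optimal
        (∃ K : SharedGain dy du k,
          (∀ t ∈ Finset.Icc 1 T, U sys ⟨K, G, H⟩ ξ t =ᵐ[μ] fun ω =>
            L t *ᵥ stat sys ⟨K, G, H⟩ ξ μ t ω + G.diag t *ᵥ Y sys ⟨K, G, H⟩ ξ t ω +
              H.diag t *ᵥ M sys ⟨K, G, H⟩ ξ t ω) ∧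
          (∀ K' : SharedGain dy du k,
            cost sys ⟨K, G, H⟩ ξ μ T ≤ cost sys ⟨K', G, H⟩ ξ μ T) ∧
          cost sys ⟨K, G, H⟩ ξ μ T = optCost sys G H T Pi) ∧
        -- every optimal strategy is of this form
        (∀ K : SharedGain dy du k,
          (∀ K' : SharedGain dy du k,
            cost sys ⟨K, G, H⟩ ξ μ T ≤ cost sys ⟨K', G, H⟩ ξ μ T) →
          ∀ t ∈ Finset.Icc 1 T, U sys ⟨K, G, H⟩ ξ t =ᵐ[μ] fun ω =>
            L t *ᵥ stat sys ⟨K, G, H⟩ ξ μ t ω + G.diag t *ᵥ Y sys ⟨K, G, H⟩ ξ t ω +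
              H.diag t *ᵥ M sys ⟨K, G, H⟩ ξ t ω)) := by
  refine ⟨fun σ => ⟨pred_one hk hξ σ, fun hdet => ⟨fun t ht => ?_, fun t ht => ?_⟩⟩, fun G H => ?_⟩
  · obtain ⟨ht1, htT⟩ := mem_Icc.1 ht
    exact pred_succ hk hξ σ hdet ht1 htT
  · obtain ⟨ht1, htT⟩ := mem_Icc.1 ht
    obtain ⟨e, he, hP⟩ := exists_isPredError_riccati hξ σ hk hdet t ht1 htT
    rw [← hP]
    exact he.condSecondMoment_eq hk htT
  -- One family of errors, built for the reference gain `0`, serves every `K`; this is what makes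
  -- `Λ` and `Pi` independent of `K`.
  obtain ⟨e, he⟩ := exists_arePredErrors hξ (⟨0, G, H⟩ : Strategy dy du k) hk
  have hex : ∀ t, ∃ (Λ : Matrix (EstIdx dx dy du k) (StatIdx dx dy du k) ℝ)
      (η : Ω → EstIdx dx dy du k → ℝ), t ∈ Icc 1 T →
      InSpan (hξ.isGaussianSpace.orth (obsSpan sys ⟨0, G, H⟩ ξ (t - k))) η ∧
      ∀ (K : SharedGain dy du k) ω,
        Sum.elim (X sys ⟨K, G, H⟩ ξ t ω) (M sys ⟨K, G, H⟩ ξ t ω) =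
          Λ *ᵥ linStat sys ⟨K, G, H⟩ ξ e t ω + η ω := by
    intro t
    by_cases ht : t ∈ Icc 1 T
    · obtain ⟨Λ, η, h⟩ := exists_stateMem_eq hk he (mem_Icc.1 ht).1 (mem_Icc.1 ht).2
      exact ⟨Λ, η, fun _ => h⟩
    · exact ⟨0, fun _ => 0, fun h => absurd h ht⟩
  choose Λ η hΛ using hex
  -- Orthogonality, obtained for the reference gain, transfers because the observation span does not
  -- depend on `K`.
  have hη (K : SharedGain dy du k) (t : ℕ) (ht : t ∈ Icc 1 T) :
      InSpan (hξ.isGaussianSpace.orth (obsSpan sys ⟨K, G, H⟩ ξ (t - k))) (η t) := by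
    rw [obsSpan_eq sys ⟨K, G, H⟩ ξ ⟨0, G, H⟩ hk]
    exact (hΛ t ht).1
  have herr (K : SharedGain dy du k) (t : ℕ) (ht : t ∈ Icc 1 T) :=
    coordErr_mem_orth (hξ := hξ) (σ := ⟨K, G, H⟩) hk (mem_Icc.1 ht).1 (mem_Icc.1 ht).2 (hη K t ht)
  have hstate (K : SharedGain dy du k) (t : ℕ) (ht : t ∈ Icc 1 T) (ω : Ω) :=
    coordState_eq (σ := ⟨K, G, H⟩) hk (mem_Icc.1 ht).1 ((hΛ t ht).2 K ω)
  have hstat (K : SharedGain dy du k) (t : ℕ) (ht : t ∈ Icc 1 T) :=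
    stat_eq_linStat (μ := μ) hk (he.change hk ⟨K, G, H⟩) (mem_Icc.1 ht).2
  have hlin (K : SharedGain dy du k) (t : ℕ) (ht : t ∈ Icc 1 T) :=
    (linStat_mem_obsSpan hk (he.change hk ⟨K, G, H⟩) (mem_Icc.1 ht).2).mulVec (embed sys k t * Λ t)
  set Pi : ℕ → Matrix (CoordIdx dx dy du k) (CoordIdx dx dy du k) ℝ := fun t =>
    crossMoment μ (coordErr sys ξ t (η t)) (coordErr sys ξ t (η t)) with hPi
  set L : ℕ → Matrix (Stack du) (StatIdx dx dy du k) ℝ := fun t =>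
    coordGain sys G H T t * embed sys k t * Λ t with hL
  have hcost (K : SharedGain dy du k) : cost sys ⟨K, G, H⟩ ξ μ T = optCost sys G H T Pi +
      ∑ t ∈ Icc 1 T, ∫ ω, deviation sys G H T t (Ut sys ⟨K, G, H⟩ ξ t ω)
        (L t *ᵥ linStat sys ⟨K, G, H⟩ ξ e t ω) ∂μ := by
    rw [cost_eq_optCost_add hξ hk ⟨K, G, H⟩ (hlin K) (herr K) (hstate K)]
    simp only [hL, hPi, Matrix.mul_assoc, mulVec_mulVec]
  have hdev (t : ℕ) (u g : Stack du → ℝ) : 0 ≤ deviation sys G H T t u g := by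
    have := (inputTerm_posDef (T := T) sys G H t (t + 1)).posSemidef.dotProduct_mulVec_nonneg (u - g)
    rwa [star_trivial] at this
  have hdev_eq (t : ℕ) (u g : Stack du → ℝ) (h : deviation sys G H T t u g = 0) : u = g := by
    by_contra hne
    have := (inputTerm_posDef (T := T) sys G H t (t + 1)).dotProduct_mulVec_pos
      (sub_ne_zero.2 hne)
    rw [star_trivial] at this
    exact this.ne' h
  have hdev_int (K : SharedGain dy du k) (t : ℕ) (ht : t ∈ Icc 1 T) :
      Integrable (fun ω => deviation sys G H T t (Ut sys ⟨K, G, H⟩ ξ t ω)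
        (L t *ᵥ linStat sys ⟨K, G, H⟩ ξ e t ω)) μ := by
    have h := (mem_Icc.1 ht).2
    have h1 := ((Ut_mem_obsSpan sys ⟨K, G, H⟩ ξ hk (le_refl (t - k))).sub
      ((linStat_mem_obsSpan hk (he.change hk ⟨K, G, H⟩) h).mulVec (L t))).mono
      (obsSpan_le_univ (T := T) sys ⟨K, G, H⟩ ξ hk (by omega))
    exact hξ.isGaussianSpace.integrable_dotProduct _ h1 h1
  have hform (K : SharedGain dy du k) (t : ℕ) (ht : t ∈ Icc 1 T)
      (h : ∀ᵐ ω ∂μ, Ut sys ⟨K, G, H⟩ ξ t ω = L t *ᵥ linStat sys ⟨K, G, H⟩ ξ e t ω) :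
      U sys ⟨K, G, H⟩ ξ t =ᵐ[μ] fun ω => L t *ᵥ stat sys ⟨K, G, H⟩ ξ μ t ω +
        G.diag t *ᵥ Y sys ⟨K, G, H⟩ ξ t ω + H.diag t *ᵥ M sys ⟨K, G, H⟩ ξ t ω := by
    filter_upwards [h, hstat K t ht] with ω h1 h2
    rw [U_eq sys ⟨K, G, H⟩ ξ hk (mem_Icc.1 ht).1, h2, ← h1]
  obtain ⟨K, hK⟩ := exists_sharedGain (G := G) (H := H) hk he L
  have hopt : cost sys ⟨K, G, H⟩ ξ μ T = optCost sys G H T Pi := by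
    rw [hcost, Finset.sum_eq_zero, add_zero]
    intro t ht
    simp only [hK t ht, deviation, sub_self, zero_dotProduct, integral_zero]
  refine ⟨Λ, Pi, L, fun K t ht => ⟨?_, ?_⟩, fun _ _ => rfl,
    fun K => integrable_pathCost hξ ⟨K, G, H⟩ hk, ⟨K, fun t ht => ?_, fun K' => ?_, hopt⟩,
    fun K' hmin t ht => ?_⟩
  · exact stateMemEst_eq hk (he.change hk ⟨K, G, H⟩) (mem_Icc.1 ht).2 (hη K t ht)
      ((hΛ t ht).2 K)
  · exact condSecondMoment_coordErr hk (he.change hk ⟨K, G, H⟩) (mem_Icc.1 ht).2 (herr K t ht)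
      (hstate K t ht)
  · exact hform K t ht (Filter.Eventually.of_forall (hK t ht))
  · rw [hopt, hcost K']
    exact le_add_of_nonneg_right
      (Finset.sum_nonneg fun t _ => integral_nonneg fun ω => hdev t _ _)
  · refine hform K' t ht ?_
    -- Comparison with the attained value `optCost` makes the sum of expected deviations
    -- nonpositive, so each of these nonnegative terms is zero.
    have h1 := hmin K
    rw [hopt, hcost K'] at h1
    have hnn : ∀ s ∈ Icc 1 T, 0 ≤ ∫ ω, deviation sys G H T s (Ut sys ⟨K', G, H⟩ ξ s ω)
        (L s *ᵥ linStat sys ⟨K', G, H⟩ ξ e s ω) ∂μ :=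
      fun s _ => integral_nonneg fun ω => hdev s _ _
    have h2 := (Finset.sum_eq_zero_iff_of_nonneg hnn).1
      (le_antisymm (by linarith) (Finset.sum_nonneg hnn)) t ht
    have h3 := (integral_eq_zero_iff_of_nonneg (fun ω => hdev t _ _) (hdev_int K' t ht)).1 h2
    filter_upwards [h3] with ω hω
    exact hdev_eq t _ _ hω
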